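/- Let $\mathbb F_{2^{10}}$ be the field with $2^{10}$ elements, let $\mathbb F_{2^5}$ be its subfield of order $32$, and let $\omega\in\mathbb F_{2^{10}}$ be an element of multiplicative order $3$. For $u\in\mathbb F_{2^{10}}^*$ put $F_u:\mathbb F_{2^{10}}\to\mathbb F_{2^{10}}$, $F_u(x)=x^3+u\,x^{36}$. For a map $F:U\to V$ between finite elementary abelian $2$-groups let $\delta_F(a,b)$ be the number of pairs $(x,y)\in U\times U$ with $x-y=a$ and $F(x)-F(y)=b$; if $|U|=|V|$, then $F$ is called almost perfect nonlinear (APN) if $\max_{(a,b)\neq(0,0)}\delta_F(a,b)=2$. Two maps $F_1,F_2:U\to V$ are called CCZ-equivalent if there are an automorphism $\mathcal L$ of the group $U\times V$ and an element $g\in U\times V$ with $\mathcal L(\{(x,F_1(x)):x\in U\})=\{(x,F_2(x))+g:x\in U\}$. Then, for every $u\in\mathbb F_{2^{10}}^*$, the map $F_u$ is APN if and only if $u\in\omega\,\mathbb F_{2^5}^*\cup\omega^2\,\mathbb F_{2^5}^*$. Moreover, for every $u$ in $\omega\,\mathbb F_{2^5}^*\cup\omega^2\,\mathbb F_{2^5}^*$,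 the map $F_u$ is not CCZ-equivalent to any power mapping $x\mapsto x^d$ ($d\in\mathbb N=\{0,1,2,\dots\}$) on $\mathbb F_{2^{10}}$. -/

import Mathlib

/-- The number `δ_F(a, b)` of pairs `(x, y)` with `x - y = a` and `F x - F y = b`. -/
noncomputable def diffCount {U V : Type*} [AddCommGroup U] [AddCommGroup V]
    (F : U → V) (a : U) (b : V) : ℕ :=
  Set.ncard {p : U × U | p.1 - p.2 = a ∧ F p.1 - F p.2 = b}

/-- The maximum of `δ_F(a, b)` over all `(a, b) ≠ (0, 0)`. -/
noncomputable def maxDiffCount {U V : Type*} [AddCommGroup U] [AddCommGroup V]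
    [Finite U] [Finite V] (F : U → V) : ℕ :=
  ⨆ p : {p : U × V // p ≠ 0}, diffCount F p.1.1 p.1.2

/-- A function between finite elementary abelian `2`-groups of the same order is almost perfect
nonlinear if the maximum of `δ_F(a, b)` over `(a, b) ≠ (0, 0)` is `2`. -/
def IsAPN {U V : Type*} [AddCommGroup U] [AddCommGroup V] [Finite U] [Finite V]
    (F : U → V) : Prop :=
  (∀ x : U, x + x = 0) ∧ (∀ y : V, y + y = 0) ∧ Nat.card U = Nat.card V ∧ maxDiffCount F = 2

/-- Two functions `U → V` are CCZ equivalent if some automorphism of the group `U × V` maps the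
graph of the first one onto a translate of the graph of the second one. -/
def CCZEquivalent {U V : Type*} [AddCommGroup U] [AddCommGroup V] (F₁ F₂ : U → V) : Prop :=
  ∃ (L : (U × V) ≃+ (U × V)) (g : U × V),
    L '' {p : U × V | p.2 = F₁ p.1} = (fun p => p + g) '' {p : U × V | p.2 = F₂ p.1}

/-!
Write `F x = x ^ 3 + u x ^ 36` and let `B` be the polar form of `F`, which is biadditive. Then `F`
is APN if and only if `B x y = 0` only for `y ∈ {0, x}` (for `x ≠ 0`).

*The APN property.* The substitution `x ↦ a x` multiplies `u` by `a ^ 33`, so that one may take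
`x = 1`. If `u ^ 31` is a primitive cube root of unity `w`, which is what membership in
`w F_32^*` means, then comparing `B 1 y = 0` with its conjugate over `F_32` eliminates `u` and
leaves one sextic equation for the coordinates of `y` over `F_32`; it has only the two obvious solutions
(`sextic_eq_zero`), which is a peculiarity of the field with `32` elements and is checked by
computation. For all other `u` one may take `u ^ 33 = 1`, and then a nontrivial zero of `B` is
written down (`exists_polarForm_cubicBinomial_eq_zero`).

*CCZ-inequivalence.* The argument rests on the fact that a function in the CCZ class of a power
function has a graph with an additional group of automorphisms, of order `1023`.

Let `F` be APN with `F (w x) = F x`. The Walsh coefficients at `0` are congruent to `1` modulo `3`;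
together with their first two moments this forces them to be `-32` or `64` for nonzero components
(`walsh_zero_and_card_radical`). So the radical of every nonzero component has one or four elements.
There are two consequences.

* The set of additive forms on `K × K` at which the Fourier transform of the graph has square `1024`
  has as group of periods exactly the forms that vanish on `{0} × K` (`isPeriod_pairForm_iff`). Hence
  `{0} × K` is invariant under all automorphisms of the graph. If `F` is CCZ-equivalent to a power
  function, it follows that `F (L x) = E x + E' (x ^ e)` with additive `L`, `E`, `E'`, where `L` and
  `E'` are bijective (`exists_linear_normal_form`).
* The sets `F_4 x` are the nontrivial radicals of nonzero components. In the normal form this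
  partition is invariant under multiplication, and therefore `L` is semilinear over `F_4`
  (`semilinear_of_normal_form`).

Finally, the coefficients of `F (L x)` are computed for `L x = ∑ a_i x ^ (4 ^ i)`. Those with
exponents in the class of `3`, modulo multiplication by `2`, do not all vanish, since
`a_i ^ 3 = u a_(i+3) ^ 32 a_(i+4) ^ 4` for all `i` would imply `u ^ 155 = 1`; the same holds for the
class of `9`. But `E x + E' (x ^ e)` has nonlinear exponents in one class only (`not_normal_form`).
-/

/-! ### Polar forms and the APN property -/

/-- The polar form `F (x + y) + F x + F y` of a function in characteristic `2`. -/
def polarForm {K : Type*} [Add K] (F : K → K) (x y : K) : K :=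
  F (x + y) + F x + F y

theorem polarForm_comm {K : Type*} [AddCommSemigroup K] (F : K → K) (x y : K) :
    polarForm F x y = polarForm F y x := by
  unfold polarForm
  rw [add_comm x y, add_right_comm]

section APN

variable {K : Type*} [Field K] [CharP K 2]

theorem add_polarForm (F : K → K) (x y : K) : F (x + y) = F x + F y + polarForm F x y := by
  unfold polarForm
  linear_combination (-F x - F y) * CharTwo.two_eq_zero (R := K)

/-- For a function whose polar form is additive, being APN means that the polar form `B` is
as nondegenerate as an alternating form can be: `B x y = 0` only for `F_2`-dependent `x`, `y`. -/
theorem isAPN_iff_polarForm [Finite K] {F : K → K} (h0 : F 0 = 0)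
    (hB : ∀ x y z, polarForm F x (y + z) = polarForm F x y + polarForm F x z) :
    IsAPN F ↔ ∀ x y, x ≠ 0 → polarForm F x y = 0 → y = 0 ∨ y = x := by
  classical
  have hbdd : BddAbove (Set.range fun p : {p : K × K // p ≠ 0} => diffCount F p.1.1 p.1.2) :=
    (Set.finite_range _).bddAbove
  have h2 : (2 : K) = 0 := CharTwo.two_eq_zero
  have hBx : ∀ x, polarForm F x x = 0 := fun x => by
    unfold polarForm
    rw [CharTwo.add_self_eq_zero x, h0]
    linear_combination F x * h2
  have key : ∀ a b x y : K, x - y = a ∧ F x - F y = b ↔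
      x = y + a ∧ F a + polarForm F a y = b := by
    intro a b x y
    constructor
    · rintro ⟨rfl, rfl⟩
      refine ⟨by ring, ?_⟩
      have h := add_polarForm F (x - y) y
      rw [sub_add_cancel] at h
      rw [h]; ring
    · rintro ⟨rfl, rfl⟩
      refine ⟨by ring, ?_⟩
      rw [add_polarForm F y a, polarForm_comm]; ring
  constructor
  · rintro ⟨-, -, -, hmax⟩ a y ha hy
    by_contra! hne
    have hle : diffCount F a (F a) ≤ 2 := by
      rw [← hmax]
      exact le_ciSup hbdd ⟨(a, F a), fun h => ha (congrArg Prod.fst h)⟩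
    have hsub : (({(a, 0), (0, a), (y + a, y)} : Finset (K × K)) : Set (K × K)) ⊆
        {p : K × K | p.1 - p.2 = a ∧ F p.1 - F p.2 = F a} := by
      intro p hp
      simp only [Finset.coe_insert, Finset.coe_singleton, Set.mem_insert_iff,
        Set.mem_singleton_iff] at hp
      rw [Set.mem_ofPred_eq, key]
      rcases hp with rfl | rfl | rfl
      · refine ⟨by simp, ?_⟩
        have := hB a 0 0
        simp only [add_zero, left_eq_add] at this
        simp [this]
      · refine ⟨by simp [CharTwo.add_self_eq_zero], by simp [hBx]⟩
      · exact ⟨rfl, by simp [hy]⟩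
    have h3 := Set.ncard_le_ncard hsub (Set.toFinite _)
    rw [Set.ncard_coe_finset, Finset.card_eq_three.mpr
      ⟨(a, 0), (0, a), (y + a, y), by simp [ha], by
        simp only [ne_eq, Prod.mk.injEq, not_and]; exact fun _ h => hne.1 h.symm, by
        simp only [ne_eq, Prod.mk.injEq, not_and]; exact fun _ h => hne.2 h.symm, rfl⟩] at h3
    exact absurd (h3.trans hle) (by norm_num)
  · intro h
    refine ⟨CharTwo.add_self_eq_zero, CharTwo.add_self_eq_zero, rfl, le_antisymm ?_ ?_⟩
    · refine ciSup_le' fun ⟨⟨a, b⟩, hp⟩ => ?_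
      unfold diffCount
      simp only [key]
      by_cases ha : a = 0
      · subst ha
        have hb : b ≠ 0 := fun hb => hp (by simp [hb])
        have : {p : K × K | p.1 = p.2 + 0 ∧ F 0 + polarForm F 0 p.2 = b} = ∅ := by
          ext p
          simp only [Set.mem_ofPred_eq, Set.mem_empty_iff_false, iff_false, not_and]
          intro _ hh
          apply hb
          rw [← hh]
          unfold polarForm
          rw [h0, zero_add, zero_add, add_zero, CharTwo.add_self_eq_zero]
        rw [this, Set.ncard_empty]
        exact Nat.zero_le _
      · -- two solutions differ by `0` or by `a`
        rcases Set.eq_empty_or_nonempty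
          {p : K × K | p.1 = p.2 + a ∧ F a + polarForm F a p.2 = b} with he | ⟨⟨x, y⟩, hx, hy⟩
        · simp [he]
        · simp only at hx hy
          refine (Set.ncard_le_ncard (t := (({(y + a, y), (y, y + a)} : Finset (K × K)) :
            Set (K × K))) ?_ (Set.toFinite _)).trans ?_
          · rintro ⟨x', y'⟩ ⟨hx', hy'⟩
            simp only at hx' hy'
            have hz : polarForm F a (y' + y) = 0 := by
              rw [hB]
              linear_combination hy' + hy + (b - F a) * h2
            have hyy : y' = (y' + y) + y := by linear_combination -y * h2
            rcases h a _ ha hz with h' | h'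
            · rw [h', zero_add] at hyy
              simp [hx', hyy]
            · rw [h'] at hyy
              have : x' = y := by rw [hx', hyy]; linear_combination a * h2
              simp [this, hyy, add_comm]
          · rw [Set.ncard_coe_finset]
            exact Finset.card_le_two
    · have h1 : diffCount F 1 (F 1) = 2 := by
        unfold diffCount
        simp only [key]
        have : {p : K × K | p.1 = p.2 + 1 ∧ F 1 + polarForm F 1 p.2 = F 1} =
            (({(1, 0), (0, 1)} : Finset (K × K)) : Set (K × K)) := by
          ext ⟨x, y⟩
          simp only [Set.mem_ofPred_eq, add_eq_left, Finset.coe_insert, Finset.coe_singleton,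
            Set.mem_insert_iff, Set.mem_singleton_iff, Prod.mk.injEq]
          constructor
          · rintro ⟨rfl, hy⟩
            rcases h 1 y one_ne_zero hy with rfl | rfl
            · simp
            · simp [CharTwo.add_self_eq_zero]
          · rintro (⟨rfl, rfl⟩ | ⟨rfl, rfl⟩)
            · refine ⟨by simp, ?_⟩
              unfold polarForm
              simp only [h0, add_zero, CharTwo.add_self_eq_zero]
            · exact ⟨by simp [CharTwo.add_self_eq_zero], hBx 1⟩
        rw [this, Set.ncard_coe_finset, Finset.card_eq_two]
        exact ⟨(1, 0), (0, 1), by simp, rfl⟩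
      rw [← h1]
      exact le_ciSup hbdd ⟨((1 : K), F 1), fun h => one_ne_zero (congrArg Prod.fst h)⟩

end APN

/-! ### A finite computation in the field with `32` elements -/

/-- Multiplication by the class `g` of `X` in `F_2[X] / (X ^ 5 + X ^ 2 + 1)`, the polynomials of
degree less than `5` being encoded by the binary digits of a natural number. -/
def mulGen (n : ℕ) : ℕ := if n < 16 then 2 * n else (2 * n) ^^^ 37

/-- The code of `g ^ i`. -/
def powGen (i : ℕ) : ℕ := mulGen^[i] 1

/-- The codes of `1, g, ..., g ^ 30`, as a table. -/
def powGenTable : List ℕ := (List.range 31).map powGen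

/-- The code of `g ^ i`, read off the table. -/
def powGenMod (i : ℕ) : ℕ := powGenTable.getD (i % 31) 0

/-- The code of the value at `P = g ^ i`, `Q = g ^ j` of the difference of the two sides of the
equation in `sextic_eq_zero`. -/
def sexticCode (i j : ℕ) : ℕ :=
  powGenMod (5 * i) ^^^ powGenMod (i + 4 * j) ^^^ powGenMod (2 * i) ^^^ powGenMod (6 * i) ^^^
    powGenMod (2 * i + 4 * j) ^^^ powGenMod (3 * i) ^^^ powGenMod (4 * i + 2 * j) ^^^
    powGenMod (i + 2 * j) ^^^ powGenMod (5 * j) ^^^ powGenMod (2 * j) ^^^ powGenMod (3 * j)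

theorem sexticCode_mem :
    ∀ i ∈ List.range 31, ∀ j ∈ List.range 31, 
    sexticCode i j ≠ 0 ∧ sexticCode i j < 32 := by
  decide +kernel

theorem powGen_mem :
    ∀ n ∈ List.range 32, n ≠ 0 → ∃ i ∈ List.range 31, powGen i = n := by
  decide +kernel

theorem powGen_lt : ∀ i ∈ List.range 31, powGen i < 32 := by
  decide +kernel

theorem ne_zero_of_gen {K : Type*} [Field K] {g : K} (hg : g ^ 5 = g ^ 2 + 1) : g ≠ 0 := by
  rintro rfl
  norm_num at hg

section Decode

variable {K : Type*} [Field K] [CharP K 2]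

/-- The element of `K` with a given code, when `g` is a root of `X ^ 5 + X ^ 2 + 1` in `K`. -/
def decode (g : K) (n : ℕ) : K :=
  ∑ i ∈ Finset.range 5, if n.testBit i then g ^ i else 0

theorem decode_xor (g : K) (m n : ℕ) : decode g (m ^^^ n) = decode g m + decode g n := by
  unfold decode
  rw [← Finset.sum_add_distrib]
  refine Finset.sum_congr rfl fun i _ => ?_
  rw [Nat.testBit_xor]
  cases m.testBit i <;> cases n.testBit i <;> simp [CharTwo.add_self_eq_zero]

theorem decode_mulGen {g : K} (hg : g ^ 5 = g ^ 2 + 1) {n : ℕ} (hn : n < 32) :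
    decode g (mulGen n) = g * decode g n := by
  have h2 : (2 : K) = 0 := CharTwo.two_eq_zero
  interval_cases n <;>
    simp [decode, mulGen, Finset.sum_range_succ, Nat.testBit, Nat.shiftRight_eq_div_pow] <;>
    grind

theorem decode_powGen {g : K} (hg : g ^ 5 = g ^ 2 + 1) {i : ℕ} (hi : i < 31) :
    decode g (powGen i) = g ^ i := by
  induction i with
  | zero => simp [powGen, decode, Finset.sum_range_succ, Nat.testBit, Nat.shiftRight_eq_div_pow]
  | succ i ih =>
    have hlt := powGen_lt i (List.mem_range.mpr (by omega))
    have : powGen (i + 1) = mulGen (powGen i) := Function.iterate_succ_apply' _ _ _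
    rw [this, decode_mulGen hg hlt, ih (by omega), pow_succ']

theorem gen_pow_thirtyone {g : K} (hg : g ^ 5 = g ^ 2 + 1) : g ^ 31 = 1 := by
  have hlt := powGen_lt 30 (by decide)
  rw [pow_succ', ← decode_powGen hg (by norm_num : 30 < 31), ← decode_mulGen hg hlt,
    show mulGen (powGen 30) = powGen 0 by decide +kernel, decode_powGen hg (by norm_num), pow_zero]

theorem decode_powGenMod {g : K} (hg : g ^ 5 = g ^ 2 + 1) (i : ℕ) :
    decode g (powGenMod i) = g ^ i := by
  have hi : i % 31 < 31 := Nat.mod_lt _ (by norm_num)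
  have : powGenMod i = powGen (i % 31) := by
    simp [powGenMod, powGenTable, hi]
  rw [this, decode_powGen hg hi, ← pow_eq_pow_mod i (gen_pow_thirtyone hg)]

end Decode

open Polynomial in
/-- The field with `32` elements contains a root of `X ^ 5 + X ^ 2 + 1`, since this polynomial
divides `X ^ 32 - X`. -/
theorem exists_gen {k : Type*} [Field k] [Fintype k] [CharP k 2] (hk : Fintype.card k = 32) :
    ∃ g : k, g ^ 5 = g ^ 2 + 1 := by
  classical
  by_contra! hne
  have h2 : (2 : k) = 0 := CharTwo.two_eq_zero
  -- the cofactor `(X ^ 32 - X) / (X ^ 5 + X ^ 2 + 1)`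
  let q : k[X] := X ^ 27 + X ^ 24 + X ^ 22 + X ^ 21 + X ^ 18 + X ^ 17 + X ^ 16 + X ^ 15 + X ^ 14 +
    X ^ 10 + X ^ 9 + X ^ 7 + X ^ 6 + X ^ 5 + X ^ 3 + X
  have hdeg : q.natDegree = 27 := by
    simp only [q]
    compute_degree!
  have hq : ∀ x ∈ (Finset.univ : Finset k), q.eval x = 0 := by
    intro x _
    have hx : x ^ 5 + x ^ 2 + 1 ≠ 0 := fun h => hne x (by linear_combination h - (x ^ 2 + 1) * h2)
    refine (mul_eq_zero.mp ?_).resolve_left hx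
    have h32 : x ^ 32 = x := by rw [← hk]; exact FiniteField.pow_card x
    simp only [q, eval_add, eval_pow, eval_X]
    grind
  have := eq_zero_of_natDegree_lt_card_of_eval_eq_zero' q Finset.univ hq
    (by rw [hdeg, Finset.card_univ, hk]; norm_num)
  rw [this] at hdeg
  simp at hdeg

/-- Every nonzero element of the field with `32` elements is a power of a root of
`X ^ 5 + X ^ 2 + 1`. -/
theorem exists_eq_gen_pow {k : Type*} [Field k] [Fintype k] [CharP k 2] (hk : Fintype.card k = 32)
    {g : k} (hg : g ^ 5 = g ^ 2 + 1) {x : k} (hx : x ≠ 0) : ∃ i < 31, x = g ^ i := by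
  classical
  have hg0 := ne_zero_of_gen hg
  have hg1 : g ≠ 1 := by
    rintro rfl
    exact one_ne_zero (by linear_combination hg + CharTwo.two_eq_zero (R := k) : (1 : k) = 0)
  have horder : orderOf (Units.mk0 g hg0) = 31 :=
    haveI : Fact (Nat.Prime 31) := ⟨by norm_num⟩
    orderOf_eq_prime (Units.ext (by simpa using gen_pow_thirtyone hg))
      (fun h => hg1 (by simpa using congrArg Units.val h))
  have htop : Subgroup.zpowers (Units.mk0 g hg0) = ⊤ := by
    apply Subgroup.eq_top_of_card_eq
    rw [Nat.card_zpowers, horder, Nat.card_units, Nat.card_eq_fintype_card, hk]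
  have hmem : Units.mk0 x hx ∈ Subgroup.zpowers (Units.mk0 g hg0) := by rw [htop]; trivial
  rw [← mem_powers_iff_mem_zpowers, mem_powers_iff_mem_range_orderOf, horder] at hmem
  obtain ⟨i, hi, h⟩ := Finset.mem_image.mp hmem
  exact ⟨i, Finset.mem_range.mp hi, by simpa using congrArg Units.val h.symm⟩

/-- Over the field with `32` elements, this plane sextic has only two affine points. As it has
further points over the fields with `4`, `8`, `16` and `64` elements, the remaining pairs of powers of
a generator are checked one by one, in `sexticCode_mem`. -/
theorem sextic_eq_zero {k : Type*} [Field k] [Fintype k] [CharP k 2] (hk : Fintype.card k = 32)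
    {P Q : k}
    (h : (P + P ^ 2 + Q ^ 2) * (P ^ 4 + Q ^ 4 + P) = (Q + Q ^ 2) * (Q ^ 4 + Q)) :
    Q = 0 ∧ (P = 0 ∨ P = 1) := by
  have h2 : (2 : k) = 0 := CharTwo.two_eq_zero
  obtain ⟨g, hg⟩ := exists_gen hk
  have frob : ∀ x : k, x ^ 32 = x := fun x => by rw [← hk]; exact FiniteField.pow_card x
  by_cases hQ : Q = 0
  · subst hQ
    refine ⟨rfl, ?_⟩
    by_contra! hP
    have hP1 : P ^ 3 = 1 ∨ P = 1 := by
      have : P ^ 2 * ((P + 1) * (P ^ 3 + 1)) = 0 := by linear_combination h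
      rcases mul_eq_zero.mp ((mul_eq_zero.mp this).resolve_left (pow_ne_zero 2 hP.1)) with h' | h'
      · right; linear_combination h' - h2
      · left; linear_combination h' - h2
    rcases hP1 with h3 | h1
    · -- `3` is prime to `31`
      apply hP.2
      have := frob P
      have h33 : P ^ 33 = 1 := by rw [show 33 = 3 * 11 from rfl, pow_mul, h3, one_pow]
      have h22 : P ^ 2 = 1 := by rw [← h33, pow_succ P 32, this, sq]
      calc P = P ^ 3 * P - (P ^ 2 - 1) * (P ^ 2) - P ^ 2 + P := by ring
        _ = 1 := by rw [h3, h22]; linear_combination (P - 1) * h2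
    · exact hP.2 h1
  exfalso
  by_cases hP : P = 0
  · subst hP
    -- here `Q` would be a root of `X ^ 3 + X + 1`, which generates the field with `8` elements
    have h3 : Q ^ 3 = Q + 1 := by
      have : Q ^ 2 * (Q ^ 3 + Q + 1) = 0 := by linear_combination -h
      linear_combination (mul_eq_zero.mp this).resolve_left (pow_ne_zero 2 hQ) - (Q + 1) * h2
    have := frob Q
    grind
  obtain ⟨i, hi, rfl⟩ := exists_eq_gen_pow hk hg hP
  obtain ⟨j, hj, rfl⟩ := exists_eq_gen_pow hk hg hQ
  have hcode : decode g (sexticCode i j) = 0 := by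
    simp only [sexticCode, decode_xor, decode_powGenMod hg]
    linear_combination h + ((g ^ j) ^ 2 + (g ^ j) ^ 3 + (g ^ j) ^ 5) * h2
  have hmem := sexticCode_mem i (List.mem_range.mpr hi) j (List.mem_range.mpr hj)
  obtain ⟨l, hl, hl'⟩ := powGen_mem _ (List.mem_range.mpr hmem.2) hmem.1
  rw [← hl', decode_powGen hg (List.mem_range.mp hl)] at hcode
  exact ne_zero_of_gen hg (eq_zero_of_pow_eq_zero hcode)

/-! ### The binomials `x ^ 3 + u x ^ 36` -/

/-- The binomial `x ^ 3 + u x ^ 36`. -/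
def cubicBinomial {K : Type*} [Semiring K] (u : K) (x : K) : K := x ^ 3 + u * x ^ 36

section FieldPow

variable {K : Type*} [Field K] [Fintype K] (hK : Fintype.card K = 1024)
include hK

theorem pow_eq_self (x : K) : x ^ 1024 = x := by
  rw [← hK]
  exact FiniteField.pow_card x

theorem pow_eq_one {x : K} (hx : x ≠ 0) : x ^ 1023 = 1 := by
  have := FiniteField.pow_card_sub_one_eq_one x hx
  rwa [hK] at this

end FieldPow

section Binomial

variable {K : Type*} [Field K] [CharP K 2]

theorem add_pow_thirtytwo (x y : K) : (x + y) ^ 32 = x ^ 32 + y ^ 32 :=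
  add_pow_char_pow x y 2 5

theorem polarForm_cubicBinomial (u x y : K) : polarForm (cubicBinomial u) x y =
    x ^ 2 * y + x * y ^ 2 + u * (x ^ 32 * y ^ 4 + x ^ 4 * y ^ 32) := by
  have h4 : (x + y) ^ 4 = x ^ 4 + y ^ 4 := add_pow_char_pow x y 2 2
  have h36 : (x + y) ^ 36 = (x ^ 32 + y ^ 32) * (x ^ 4 + y ^ 4) := by
    rw [← h4, ← add_pow_thirtytwo]; ring
  unfold polarForm cubicBinomial
  rw [h36]
  linear_combination (x ^ 3 + y ^ 3 + u * x ^ 36 + u * y ^ 36 + x ^ 2 * y + x * y ^ 2) *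
    CharTwo.two_eq_zero (R := K)

theorem polarForm_cubicBinomial_add (u x y z : K) : polarForm (cubicBinomial u) x (y + z) =
    polarForm (cubicBinomial u) x y + polarForm (cubicBinomial u) x z := by
  have h4 : (y + z) ^ 4 = y ^ 4 + z ^ 4 := add_pow_char_pow y z 2 2
  rw [polarForm_cubicBinomial, polarForm_cubicBinomial, polarForm_cubicBinomial, h4,
    add_pow_thirtytwo]
  linear_combination x * y * z * CharTwo.two_eq_zero (R := K)

/-- Substituting `x ↦ a x` in `x ^ 3 + u x ^ 36` changes `u` into `a ^ 33 u`. -/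
theorem polarForm_cubicBinomial_mul (u a x y : K) : polarForm (cubicBinomial u) (a * x) (a * y) =
    a ^ 3 * polarForm (cubicBinomial (a ^ 33 * u)) x y := by
  rw [polarForm_cubicBinomial, polarForm_cubicBinomial]
  ring

theorem isAPN_cubicBinomial_iff [Finite K] (u : K) : IsAPN (cubicBinomial u) ↔
    ∀ x y, x ≠ 0 → polarForm (cubicBinomial u) x y = 0 → y = 0 ∨ y = x :=
  isAPN_iff_polarForm (by simp [cubicBinomial]) (polarForm_cubicBinomial_add u)

variable [Fintype K] (hK : Fintype.card K = 1024)
include hK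

/-- The sufficient condition for being APN. The conjugate over `F_32` of the equation
`y ^ 2 + y = u (y ^ 4 + y ^ 32)` allows for eliminating `u`; what remains is an equation for the
coordinates of `y` over `F_32`. -/
theorem polarForm_cubicBinomial_eq_zero {k : Subfield K} (hk : ∀ z, z ∈ k ↔ z ^ 32 = z)
    (hcard : Nat.card k = 32) {w u : K} (hw : w ^ 2 + w + 1 = 0) (hu : u ^ 31 = w) {x y : K}
    (hx : x ≠ 0) (h : polarForm (cubicBinomial u) x y = 0) : y = 0 ∨ y = x := by
  have h2 : (2 : K) = 0 := CharTwo.two_eq_zero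
  obtain ⟨z, rfl⟩ : ∃ z, y = x * z := ⟨y / x, by field_simp⟩
  obtain ⟨v, hv⟩ : ∃ v, v = x ^ 33 * u := ⟨_, rfl⟩
  have hv31 : v ^ 31 = w := by
    rw [hv, mul_pow, ← pow_mul, hu, pow_eq_one hK hx, one_mul]
  have hv32 : v ^ 32 = w * v := by rw [← hv31]; ring
  obtain ⟨t, ht⟩ : ∃ t, t = z ^ 32 := ⟨_, rfl⟩
  have ht32 : t ^ 32 = z := by rw [ht, ← pow_mul]; exact pow_eq_self hK z
  have h1 : z + z ^ 2 = v * (z ^ 4 + t) := by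
    have h' : polarForm (cubicBinomial u) (x * 1) (x * z) = 0 := by rwa [mul_one]
    rw [polarForm_cubicBinomial_mul, ← hv, polarForm_cubicBinomial] at h'
    have := (mul_eq_zero.mp h').resolve_left (pow_ne_zero 3 hx)
    rw [ht]
    linear_combination this - v * (z ^ 4 + z ^ 32) * h2
  have h1' : t + t ^ 2 = w * v * (t ^ 4 + z) := by
    have := congrArg (· ^ 32) h1
    simp only [mul_pow, add_pow_thirtytwo] at this
    rw [hv32, ← pow_mul, ← pow_mul, mul_comm 2, mul_comm 4, pow_mul, pow_mul, ← ht, ht32] at this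
    exact this
  have hE : (t + t ^ 2) * (z ^ 4 + t) = w * ((z + z ^ 2) * (t ^ 4 + z)) := by
    rw [h1, h1']; ring
  have hw3 : w ^ 3 = 1 := by linear_combination (w - 1) * hw
  have hw32 : w ^ 32 = w ^ 2 := by
    rw [show 32 = 3 * 10 + 2 from rfl, pow_add, pow_mul, hw3, one_pow, one_mul]
  have hQk : z + t ∈ k := by
    rw [hk, add_pow_thirtytwo, ht32, ← ht, add_comm]
  have hPk : z + (z + t) * w ∈ k := by
    rw [hk, add_pow_thirtytwo, mul_pow, (hk _).mp hQk, hw32, ← ht]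
    linear_combination (z + t) * hw - (z + w * t + z * w) * h2
  obtain ⟨P, hP⟩ : ∃ P : k, (P : K) = z + (z + t) * w := ⟨⟨_, hPk⟩, rfl⟩
  obtain ⟨Q, hQ⟩ : ∃ Q : k, (Q : K) = z + t := ⟨⟨_, hQk⟩, rfl⟩
  have hz : z = P + Q * w := by rw [hP, hQ]; linear_combination -((z + t) * w) * h2
  have ht' : t = P + Q * w ^ 2 := by rw [hP, hQ]; linear_combination -(z + t) * hw + t * h2
  have hsextic : ((P : K) + P ^ 2 + Q ^ 2) * (P ^ 4 + Q ^ 4 + P) = (Q + Q ^ 2) * (Q ^ 4 + Q) := by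
    rw [hz, ht'] at hE
    clear hz ht' hP hQ ht ht32 h1 h1' hu hv hv31 hv32 hPk hQk h
    grind
  have : Fintype k := Fintype.ofFinite k
  have hQP := sextic_eq_zero (k := k) (by rw [← Nat.card_eq_fintype_card, hcard])
    (P := P) (Q := Q) (Subtype.ext (by simpa using hsextic))
  obtain ⟨rfl, rfl | rfl⟩ := hQP
  · left; rw [hz]; simp
  · right; rw [hz]; simp

end Binomial

/-! ### Nontrivial zeros of the polar form -/

section NotAPN

variable {K : Type*} [Field K] [CharP K 2]

/-- For `z` of order dividing `33` but different from `3`, the polar form of `x ^ 3 + z x ^ 36` has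
a nontrivial zero. For each of the minimal polynomials over `F_2`, of degrees `1`, `10`, `10`, `10`,
there is a zero whose coordinates are sums of few powers of `z` (and of the cube root of unity `w`
if `z = 1`). -/
theorem exists_polarForm_cubicBinomial_eq_zero {z w : K} (hw : w ^ 2 + w + 1 = 0)
    (hz : z ^ 33 = 1) (hz3 : z ^ 2 + z + 1 ≠ 0) :
    ∃ x y, x ≠ 0 ∧ y ≠ 0 ∧ y ≠ x ∧ polarForm (cubicBinomial z) x y = 0 := by
  have h2 : (2 : K) = 0 := CharTwo.two_eq_zero
  have hpow : ∀ q r : ℕ, z ^ (33 * q + r) = z ^ r := fun q r => by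
    rw [pow_add, pow_mul, hz, one_pow, one_mul]
  have hsq : ∀ a b : K, (a + b) ^ 2 = a ^ 2 + b ^ 2 := fun a b => add_pow_char_pow a b 2 1
  have hfour : ∀ a b : K, (a + b) ^ 4 = a ^ 4 + b ^ 4 := fun a b => add_pow_char_pow a b 2 2
  have hprod : (z + 1) * (z ^ 2 + z + 1) *
      (z ^ 10 + z ^ 9 + z ^ 8 + z ^ 7 + z ^ 6 + z ^ 5 + z ^ 4 + z ^ 3 + z ^ 2 + z + 1) *
      (z ^ 10 + z ^ 7 + z ^ 5 + z ^ 3 + 1) * (z ^ 10 + z ^ 9 + z ^ 5 + z + 1) = 0 := by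
    grind
  rcases mul_eq_zero.mp hprod with hprod | h
  · rcases mul_eq_zero.mp hprod with hprod | h
    · rcases mul_eq_zero.mp hprod with hprod | h
      · have h := (mul_eq_zero.mp hprod).resolve_right hz3
        obtain rfl : z = 1 := by linear_combination h - h2
        refine ⟨1, w, one_ne_zero, ?_, ?_, ?_⟩
        · rintro rfl; simp at hw
        · rintro rfl; exact hz3 (by linear_combination hw)
        · have hw3 : w ^ 3 = 1 := by linear_combination (w - 1) * hw
          have hw4 : w ^ 4 = w := by linear_combination w * hw3
          have hw32 : w ^ 32 = w ^ 2 := by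
            rw [show 32 = 3 * 10 + 2 from rfl, pow_add, pow_mul, hw3, one_pow, one_mul]
          rw [polarForm_cubicBinomial, hw4, hw32]
          linear_combination (w + w ^ 2) * h2
      · refine ⟨1 + z ^ 3, z ^ 5 + z ^ 7 + z ^ 8, by grind, by grind, by grind, ?_⟩
        rw [polarForm_cubicBinomial]
        simp only [hsq, hfour, add_pow_thirtytwo, ← pow_mul, one_pow]
        have h1 := hpow 2 30
        have h3 := hpow 4 28
        have h4 := hpow 6 26
        have h5 := hpow 7 25
        norm_num at h1 h3 h4 h5 ⊢
        rw [h1, h3, h4, h5]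
        grind
    · refine ⟨1 + z ^ 4, z ^ 10 + z ^ 16, by grind, by grind, by grind, ?_⟩
      rw [polarForm_cubicBinomial]
      simp only [hsq, hfour, add_pow_thirtytwo, ← pow_mul, one_pow]
      have h1 := hpow 3 29
      have h3 := hpow 9 23
      have h4 := hpow 15 17
      norm_num at h1 h3 h4 ⊢
      rw [h1, h3, h4]
      grind
  · refine ⟨1 + z ^ 8, z ^ 16 + z ^ 29, by grind, by grind, by grind, ?_⟩
    rw [polarForm_cubicBinomial]
    simp only [hsq, hfour, add_pow_thirtytwo, ← pow_mul, one_pow]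
    have h1 := hpow 7 25
    have h3 := hpow 15 17
    have h4 := hpow 28 4
    norm_num at h1 h3 h4 ⊢
    rw [h1, h3, h4]
    grind

/-- The necessary condition for being APN: scaling the variable by `u ^ (-264)` turns `u` into
`u ^ (-527)`, whose `33`rd power is `1`. -/
theorem exists_polarForm_cubicBinomial_eq_zero' [Fintype K] (hK : Fintype.card K = 1024) {u w : K}
    (hw : w ^ 2 + w + 1 = 0) (hu : u ≠ 0) (hne : u ^ 31 ≠ w) (hne' : u ^ 31 ≠ w ^ 2) :
    ∃ x y, x ≠ 0 ∧ y ≠ 0 ∧ y ≠ x ∧ polarForm (cubicBinomial u) x y = 0 := by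
  have hu1 := pow_eq_one hK hu
  -- modulo `1023`, `759 = -264` and `33 * 759 + 1 = 496 = -527`
  have hz : (u ^ 759) ^ 33 * u = u ^ 496 := by
    rw [← pow_mul, ← pow_succ, show 759 * 33 + 1 = 1023 * 24 + 496 from rfl, pow_add, pow_mul, hu1,
      one_pow, one_mul]
  have h33 : (u ^ 496) ^ 33 = 1 := by
    rw [← pow_mul, show 496 * 33 = 1023 * 16 from rfl, pow_mul, hu1, one_pow]
  have h31 : u ^ 31 = (u ^ 496) ^ 31 := by
    rw [← pow_mul, show 496 * 31 = 1023 * 15 + 31 from rfl, pow_add, pow_mul, hu1, one_pow, one_mul]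
  have hz3 : (u ^ 496) ^ 2 + u ^ 496 + 1 ≠ 0 := by
    intro h
    generalize u ^ 496 = z at *
    have hzc : z ^ 3 = 1 := by linear_combination (z - 1) * h
    have hz31 : u ^ 31 = z := by
      rw [h31, show 31 = 3 * 10 + 1 from rfl, pow_add, pow_mul, hzc, one_pow, one_mul, pow_one]
    have : (z - w) * (z - w ^ 2) = 0 := by
      linear_combination h - (z - w + 1) * hw
    rcases mul_eq_zero.mp this with h' | h'
    · exact hne (by rw [hz31]; linear_combination h')
    · exact hne' (by rw [hz31]; linear_combination h')
  obtain ⟨x, y, hx, hy, hxy, h⟩ := exists_polarForm_cubicBinomial_eq_zero hw h33 hz3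
  have hu0 : u ^ 759 ≠ 0 := pow_ne_zero _ hu
  refine ⟨u ^ 759 * x, u ^ 759 * y, mul_ne_zero hu0 hx, mul_ne_zero hu0 hy,
    fun h' => hxy (mul_left_cancel₀ hu0 h'), ?_⟩
  rw [polarForm_cubicBinomial_mul, hz, h, mul_zero]

end NotAPN

/-! ### Characters of elementary abelian `2`-groups -/

/-- The nontrivial character of `ZMod 2`, with values in `ℤ`. -/
def sgn (z : ZMod 2) : ℤ := if z = 0 then 1 else -1

theorem sgn_zero : sgn 0 = 1 := rfl

theorem sgn_add : ∀ y z : ZMod 2, sgn (y + z) = sgn y * sgn z := by decide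

theorem sgn_eq_one_iff : ∀ z : ZMod 2, sgn z = 1 ↔ z = 0 := by decide

theorem sgn_eq_one_or : ∀ z : ZMod 2, sgn z = 1 ∨ sgn z = -1 := by decide

open Classical in
theorem sum_sgn {A : Type*} [AddCommGroup A] [Fintype A] (η : A →+ ZMod 2) :
    ∑ x, sgn (η x) = if ∀ x, η x = 0 then (Fintype.card A : ℤ) else 0 := by
  split_ifs with h
  · simp [h, sgn_zero]
  · push Not at h
    obtain ⟨a, ha⟩ := h
    have h1 : ∑ x, sgn (η x) = ∑ x, sgn (η (x + a)) :=
      (Equiv.sum_comp (Equiv.addRight a) fun x => sgn (η x)).symm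
    have h2 : sgn (η a) = -1 :=
      (sgn_eq_one_or _).resolve_left fun h => ha ((sgn_eq_one_iff _).mp h)
    simp only [map_add, sgn_add, h2, mul_neg, mul_one, Finset.sum_neg_distrib] at h1
    linarith

theorem three_dvd_card {A : Type*} [DecidableEq A] (s : Finset A) (f : A → A)
    (hf : ∀ x ∈ s, f x ∈ s) (hf3 : ∀ x, f (f (f x)) = x) (hfix : ∀ x ∈ s, f x ≠ x) :
    3 ∣ s.card := by
  let g : Function.End s := fun x => ⟨f x, hf x x.2⟩
  have hg : g ^ 3 ^ 1 = 1 := by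
    funext x
    exact Subtype.ext (hf3 x)
  have h := Equiv.Perm.card_fixedPoints_modEq (p := 3) hg
  have h0 : Fintype.card (Function.fixedPoints g) = 0 := by
    rw [Fintype.card_eq_zero_iff]
    exact ⟨fun x => hfix x.1 x.1.2 (congrArg Subtype.val x.2)⟩
  rw [h0, Fintype.card_coe] at h
  exact (Nat.modEq_zero_iff_dvd).mp h

/-! ### Walsh coefficients of quadratic `3`-to-`1` APN functions -/

/-- An APN function with additive polar form that is invariant under multiplication by the
primitive cube root of unity `w`. -/
structure IsTriplicateAPN {K : Type*} [Field K] (w : K) (F : K → K) : Prop where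
  root : w ^ 2 + w + 1 = 0
  apply_mul : ∀ x, F (w * x) = F x
  polar_add : ∀ x y z, polarForm F x (y + z) = polarForm F x y + polarForm F x z
  apn : ∀ x y, x ≠ 0 → polarForm F x y = 0 → y = 0 ∨ y = x

namespace IsTriplicateAPN

section

variable {K : Type*} [Field K] {w : K} {F : K → K} (hF : IsTriplicateAPN w F)
include hF

theorem w_ne_zero : w ≠ 0 := by
  intro h
  have := hF.root
  simp [h] at this

theorem w_cube : w ^ 3 = 1 := by linear_combination (w - 1) * hF.root

theorem polar_zero (x : K) : polarForm F x 0 = 0 := by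
  simpa using hF.polar_add x 0 0

theorem polar_zero_left (x : K) : polarForm F 0 x = 0 := by
  rw [polarForm_comm, hF.polar_zero]

theorem polar_mul_left (x y : K) : polarForm F (w * x) y = polarForm F x (w ^ 2 * y) := by
  have h : y = w * (w ^ 2 * y) := by linear_combination -y * hF.w_cube
  unfold polarForm
  conv_lhs => rw [h, ← mul_add, hF.apply_mul, hF.apply_mul, hF.apply_mul]

theorem range_polarForm_mul (x : K) :
    Set.range (polarForm F (w * x)) = Set.range (polarForm F x) := by
  ext z
  constructor
  · rintro ⟨y, rfl⟩
    exact ⟨w ^ 2 * y, (hF.polar_mul_left x y).symm⟩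
  · rintro ⟨y, rfl⟩
    refine ⟨w * y, ?_⟩
    rw [hF.polar_mul_left, ← mul_assoc, ← pow_succ, hF.w_cube, one_mul]

end

variable {K : Type*} [Field K] [CharP K 2] {w : K} {F : K → K} (hF : IsTriplicateAPN w F)
include hF

theorem w_ne_one : w ≠ 1 := by
  intro h
  have := hF.root
  rw [h] at this
  exact one_ne_zero (by linear_combination this - CharTwo.two_eq_zero (R := K) : (1 : K) = 0)

theorem w_sq : w ^ 2 = w + 1 := by
  linear_combination hF.root - (w + 1) * CharTwo.two_eq_zero (R := K)

theorem apply_zero : F 0 = 0 := by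
  have := hF.polar_zero 0
  unfold polarForm at this
  rwa [add_zero, CharTwo.add_self_eq_zero, zero_add] at this

theorem polar_self (x : K) : polarForm F x x = 0 := by
  unfold polarForm
  rw [CharTwo.add_self_eq_zero, hF.apply_zero, zero_add, CharTwo.add_self_eq_zero]

/-- The four values of `F` on the `F_2`-span of `x` and `w x` are `0`, `F x`, `F x`, `F x`. -/
theorem polar_w_mul (x : K) : polarForm F x (w * x) = F x := by
  have h : x + w * x = w * (w * x) := by linear_combination -x * hF.w_sq
  unfold polarForm
  rw [h, hF.apply_mul, hF.apply_mul, CharTwo.add_self_eq_zero, zero_add]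

/-- The polar form as an additive map in its second argument. -/
def polarHom (x : K) : K →+ K where
  toFun := polarForm F x
  map_zero' := hF.polar_zero x
  map_add' := hF.polar_add x

theorem eq_zero_of_map_eq_zero {x : K} (hx : F x = 0) : x = 0 := by
  by_contra h
  rcases hF.apn x (w * x) h (by rw [hF.polar_w_mul, hx]) with h' | h'
  · exact mul_ne_zero hF.w_ne_zero h h'
  · exact hF.w_ne_one (mul_right_cancel₀ h (by rw [h', one_mul]))

end IsTriplicateAPN

section Walsh

variable {K : Type*} [Field K] [Fintype K]

/-- The Walsh coefficient of `F` at `(a, c)`, with respect to the additive form `τ`. -/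
def walsh (τ : K →+ ZMod 2) (F : K → K) (a c : K) : ℤ := ∑ x, sgn (τ (a * x + c * F x))

open Classical in
/-- The radical of the component `τ (c F)`, that is, of its polar form. -/
noncomputable def radical (τ : K →+ ZMod 2) (F : K → K) (c : K) : Finset K :=
  Finset.univ.filter fun h => ∀ x, τ (c * polarForm F h x) = 0

theorem mem_radical {τ : K →+ ZMod 2} {F : K → K} {c h : K} :
    h ∈ radical τ F c ↔ ∀ x, τ (c * polarForm F h x) = 0 := by
  simp [radical]

/-- Orthogonality of the characters `x ↦ sgn (τ (c x))`. -/
theorem sum_sgn_mul [DecidableEq K] {τ : K →+ ZMod 2} (hτ : τ ≠ 0) (z : K) :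
    ∑ c, sgn (τ (c * z)) = if z = 0 then (Fintype.card K : ℤ) else 0 := by
  have h := sum_sgn (τ.comp (AddMonoidHom.mulRight z))
  simp only [AddMonoidHom.comp_apply, AddMonoidHom.mulRight_apply] at h
  rw [h]
  congr 1
  refine propext ⟨fun h => ?_, fun h => by simp [h]⟩
  by_contra hz
  exact hτ (AddMonoidHom.ext fun x => by simpa [hz] using h (x / z))

/-- Fourier inversion: the Walsh coefficients `W(0, c)` count the preimages of `z` under `F`. -/
theorem sum_walsh_mul_sgn [CharP K 2] [DecidableEq K] {τ : K →+ ZMod 2} (hτ : τ ≠ 0)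
    (F : K → K) (z : K) :
    ∑ c, walsh τ F 0 c * sgn (τ (c * z)) =
      Fintype.card K * (Finset.univ.filter fun x => F x = z).card := by
  have h1 : ∀ c x : K, sgn (τ (0 * x + c * F x)) * sgn (τ (c * z)) = sgn (τ (c * (F x + z))) :=
    fun c x => by rw [zero_mul, zero_add, ← sgn_add, ← map_add, mul_add]
  simp only [walsh, Finset.sum_mul, h1]
  rw [Finset.sum_comm]
  simp only [sum_sgn_mul hτ, CharTwo.add_eq_zero]
  rw [← Finset.sum_filter]
  simp [mul_comm]

theorem IsTriplicateAPN.zero_mem_radical {w : K} {F : K → K} (hF : IsTriplicateAPN w F)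
    {τ : K →+ ZMod 2} (c : K) : 0 ∈ radical τ F c := by
  simp [mem_radical, hF.polar_zero_left]

theorem IsTriplicateAPN.mul_mem_radical {w : K} {F : K → K} (hF : IsTriplicateAPN w F)
    {τ : K →+ ZMod 2} {c h : K} (hh : h ∈ radical τ F c) : w * h ∈ radical τ F c := by
  rw [mem_radical] at *
  intro x
  rw [hF.polar_mul_left, hh]

end Walsh

namespace IsTriplicateAPN

variable {K : Type*} [Field K] [CharP K 2] {w : K} {F : K → K} (hF : IsTriplicateAPN w F)
  [Fintype K] {τ : K →+ ZMod 2}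
include hF

theorem form_mul_eq_zero_of_mem_radical {c h : K} (hh : h ∈ radical τ F c) : τ (c * F h) = 0 := by
  rw [← hF.polar_w_mul]
  exact mem_radical.mp hh _

/-- The square of a Walsh coefficient as a character sum over the radical. -/
theorem walsh_sq (a c : K) : walsh τ F a c ^ 2 =
    Fintype.card K * ∑ h ∈ radical τ F c, sgn (τ (a * h + c * F h)) := by
  classical
  have h1 : ∀ x h : K, sgn (τ (a * x + c * F x)) * sgn (τ (a * (x + h) + c * F (x + h))) =
      sgn (τ (a * h + c * F h)) * sgn (τ (c * polarForm F h x)) := by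
    intro x h
    rw [← sgn_add, ← sgn_add, ← map_add, ← map_add, add_polarForm F, polarForm_comm F h x]
    congr 2
    linear_combination (a * x + c * F x) * CharTwo.two_eq_zero (R := K)
  calc walsh τ F a c ^ 2
      = ∑ x, ∑ h, sgn (τ (a * x + c * F x)) * sgn (τ (a * (x + h) + c * F (x + h))) := by
        rw [sq, walsh, Finset.sum_mul_sum]
        refine Finset.sum_congr rfl fun x _ => ?_
        exact (Equiv.sum_comp (Equiv.addLeft x) fun y =>
          sgn (τ (a * x + c * F x)) * sgn (τ (a * y + c * F y))).symm
    _ = ∑ h, sgn (τ (a * h + c * F h)) * ∑ x, sgn (τ (c * polarForm F h x)) := by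
        rw [Finset.sum_comm]
        refine Finset.sum_congr rfl fun h _ => ?_
        rw [Finset.mul_sum]
        exact Finset.sum_congr rfl fun x _ => h1 x h
    _ = ∑ h, if h ∈ radical τ F c then Fintype.card K * sgn (τ (a * h + c * F h)) else 0 := by
        refine Finset.sum_congr rfl fun h _ => ?_
        have h2 := sum_sgn ((τ.comp (AddMonoidHom.mulLeft c)).comp (hF.polarHom h))
        change ∑ x, sgn (τ (c * polarForm F h x)) = _ at h2
        rw [h2, mul_ite, mul_zero, mul_comm]
        exact if_congr mem_radical.symm rfl rfl
    _ = _ := by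
        rw [← Finset.sum_filter, Finset.filter_mem_eq_inter, Finset.univ_inter, Finset.mul_sum]

theorem walsh_zero_sq (c : K) :
    walsh τ F 0 c ^ 2 = Fintype.card K * (radical τ F c).card := by
  rw [hF.walsh_sq]
  congr 1
  rw [Finset.sum_congr rfl fun h hh => by
    rw [zero_mul, zero_add, hF.form_mul_eq_zero_of_mem_radical hh, sgn_zero]]
  simp

/-- A nonzero `h` belongs to the radical of exactly two components, the zero one included. -/
theorem card_filter_mem_radical [DecidableEq K] (hτ : τ ≠ 0) {h : K} (hh : h ≠ 0) :
    (Finset.univ.filter fun c => h ∈ radical τ F c).card = 2 := by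
  have h1 : ∑ c, ∑ x, sgn (τ (c * polarForm F h x)) =
      Fintype.card K * ((Finset.univ.filter fun c => h ∈ radical τ F c).card : ℤ) := by
    have : ∀ c, ∑ x, sgn (τ (c * polarForm F h x)) =
        if h ∈ radical τ F c then (Fintype.card K : ℤ) else 0 := by
      intro c
      have h2 := sum_sgn ((τ.comp (AddMonoidHom.mulLeft c)).comp (hF.polarHom h))
      change ∑ x, sgn (τ (c * polarForm F h x)) = _ at h2
      rw [h2]
      exact if_congr mem_radical.symm rfl rfl
    simp only [this]
    rw [← Finset.sum_filter]
    simp [mul_comm]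
  have h2 : ∑ c, ∑ x, sgn (τ (c * polarForm F h x)) = Fintype.card K * (2 : ℤ) := by
    rw [Finset.sum_comm]
    simp only [sum_sgn_mul hτ]
    rw [← Finset.sum_filter]
    have : (Finset.univ.filter fun x => polarForm F h x = 0) = {0, h} := by
      ext x
      simp only [Finset.mem_filter, Finset.mem_univ, true_and, Finset.mem_insert,
        Finset.mem_singleton]
      refine ⟨hF.apn h x hh, ?_⟩
      rintro (rfl | rfl)
      · exact hF.polar_zero _
      · exact hF.polar_self _
    rw [this, Finset.sum_const, Finset.card_pair hh.symm]
    simp [mul_comm]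
  have hc : (Fintype.card K : ℤ) ≠ 0 := by simp
  exact_mod_cast mul_left_cancel₀ hc (h1.symm.trans h2)

theorem sum_card_radical (hτ : τ ≠ 0) :
    ∑ c, ((radical τ F c).card : ℤ) = 3 * Fintype.card K - 2 := by
  classical
  have h1 : ∑ c, ((radical τ F c).card : ℤ) =
      ∑ h, ((Finset.univ.filter fun c => h ∈ radical τ F c).card : ℤ) := by
    simp only [Finset.card_filter, Nat.cast_sum]
    rw [Finset.sum_comm]
    refine Finset.sum_congr rfl fun c _ => ?_
    rw [← Nat.cast_sum, ← Finset.card_filter, Finset.filter_mem_eq_inter, Finset.univ_inter]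
  rw [h1, ← Finset.add_sum_erase _ _ (Finset.mem_univ 0)]
  rw [Finset.sum_congr rfl fun h hh => by
    rw [hF.card_filter_mem_radical hτ (Finset.ne_of_mem_erase hh)]]
  simp only [hF.zero_mem_radical, Finset.filter_true, Finset.card_univ, Finset.sum_const,
    Finset.card_erase_of_mem (Finset.mem_univ (0 : K)), nsmul_eq_mul]
  rw [Nat.cast_sub Fintype.card_pos]
  push_cast
  ring

theorem three_dvd_walsh_sub (c : K) : (3 : ℤ) ∣ walsh τ F 0 c - Fintype.card K := by
  classical
  have h1 : walsh τ F 0 c =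
      Fintype.card K - 2 * (Finset.univ.filter fun x => τ (c * F x) ≠ 0).card := by
    have : ∀ x, sgn (τ (0 * x + c * F x)) = 1 - 2 * if τ (c * F x) ≠ 0 then 1 else 0 := by
      intro x
      rw [zero_mul, zero_add, sgn]
      split_ifs <;> simp_all
    simp only [walsh, this]
    rw [Finset.sum_sub_distrib, ← Finset.mul_sum, Finset.sum_boole]
    simp
  have h2 : 3 ∣ (Finset.univ.filter fun x => τ (c * F x) ≠ 0).card := by
    refine three_dvd_card _ (fun x => w * x) ?_ ?_ ?_
    · intro x hx
      simpa [hF.apply_mul] using hx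
    · intro x
      linear_combination x * hF.w_cube
    · intro x hx hxx
      have hx0 : x ≠ 0 := by
        rintro rfl
        simp [hF.apply_zero] at hx
      exact hF.w_ne_one (mul_right_cancel₀ hx0 (by rw [hxx, one_mul]))
  rw [h1]
  obtain ⟨m, hm⟩ := h2
  exact ⟨-2 * m, by rw [hm]; push_cast; ring⟩

end IsTriplicateAPN

/-! ### The Walsh spectrum -/

namespace IsTriplicateAPN

variable {K : Type*} [Field K] [CharP K 2] {w : K} {F : K → K} (hF : IsTriplicateAPN w F)
  [Fintype K] (hK : Fintype.card K = 1024) {τ : K →+ ZMod 2} (hτ : τ ≠ 0)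
include hF hK hτ

/-- The Walsh spectrum. With `W = 32 v`, invariance under `w` gives `v ≡ 2` modulo `3`, hence
`(v + 1) (v - 2) ≥ 0`. As the sum of these numbers over all nonzero components vanishes, every `v`
is `-1` or `2`. -/
theorem walsh_zero_and_card_radical {c : K} (hc : c ≠ 0) :
    (walsh τ F 0 c = -32 ∧ (radical τ F c).card = 1) ∨
      (walsh τ F 0 c = 64 ∧ (radical τ F c).card = 4) := by
  classical
  have hv : ∀ c, ∃ v : ℤ, walsh τ F 0 c = 32 * v ∧ v ^ 2 = (radical τ F c).card := by
    intro c
    have h := hF.walsh_zero_sq (τ := τ) c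
    rw [hK] at h
    have hdvd : (32 : ℤ) ∣ walsh τ F 0 c := by
      rw [← Int.pow_dvd_pow_iff two_ne_zero, h]
      exact ⟨(radical τ F c).card, by norm_num⟩
    obtain ⟨v, hv⟩ := hdvd
    refine ⟨v, hv, ?_⟩
    rw [hv] at h
    push_cast at h
    linarith
  choose v hv hv2 using hv
  have hmod : ∀ c, v c % 3 = 2 := by
    intro c
    have h := hF.three_dvd_walsh_sub (τ := τ) c
    rw [hv, hK] at h
    push_cast at h
    omega
  have hv0 : v 0 = 32 := by
    have : walsh τ F 0 0 = 1024 := by simp [walsh, sgn_zero, hK]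
    rw [hv] at this
    linarith
  have hsum : ∑ c, v c = 32 := by
    have h := sum_walsh_mul_sgn hτ F 0
    have h1 : (Finset.univ.filter fun x => F x = 0) = {0} := by
      ext x
      simp only [Finset.mem_filter, Finset.mem_univ, true_and, Finset.mem_singleton]
      exact ⟨hF.eq_zero_of_map_eq_zero, fun h => by rw [h, hF.apply_zero]⟩
    rw [h1, hK] at h
    simp only [mul_zero, map_zero, sgn_zero, mul_one, hv, ← Finset.mul_sum] at h
    norm_num at h
    linarith
  have hsum2 : ∑ c, v c ^ 2 = 3070 := by
    simp only [hv2]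
    rw [hF.sum_card_radical hτ, hK]
    norm_num
  have hzero : ∑ c ∈ Finset.univ.erase 0, (v c ^ 2 - v c - 2) = 0 := by
    have h := Finset.add_sum_erase Finset.univ (fun c => v c ^ 2 - v c - 2) (Finset.mem_univ 0)
    simp only [Finset.sum_sub_distrib, hsum, hsum2, hv0, Finset.sum_const, Finset.card_univ, hK]
      at h ⊢
    norm_num at h ⊢
    linarith
  have hnonneg : ∀ c ∈ Finset.univ.erase 0, 0 ≤ v c ^ 2 - v c - 2 := by
    intro c _
    have hm := hmod c
    rcases le_or_gt (v c) (-1) with h | h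
    · nlinarith
    · have : 2 ≤ v c := by omega
      nlinarith
  have h := (Finset.sum_eq_zero_iff_of_nonneg hnonneg).mp hzero c (by simp [hc])
  have h' : (v c + 1) * (v c - 2) = 0 := by linarith
  have hcard := hv2 c
  rcases mul_eq_zero.mp h' with h | h
  · left
    have : v c = -1 := by linarith
    rw [this] at hcard
    exact ⟨by rw [hv, this]; norm_num, by norm_num at hcard; omega⟩
  · right
    have : v c = 2 := by linarith
    rw [this] at hcard
    exact ⟨by rw [hv, this]; norm_num, by norm_num at hcard; omega⟩

/-- Whether the square of a Walsh coefficient equals `1024` depends on the component only. -/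
theorem walsh_sq_eq_iff (a c : K) :
    walsh τ F a c ^ 2 = 1024 ↔ (radical τ F c).card = 1 := by
  have h := hF.walsh_sq (τ := τ) a c
  rw [hK] at h
  have hparity : (∑ h ∈ radical τ F c, sgn (τ (a * h + c * F h))) % 2 =
      ((radical τ F c).card : ℤ) % 2 := by
    rw [Finset.sum_int_mod, Finset.sum_congr rfl fun h _ => show _ = (1 : ℤ) by
      rcases sgn_eq_one_or (τ (a * h + c * F h)) with h | h <;> rw [h] <;> norm_num]
    simp
  constructor
  · intro h1
    rw [h1] at h
    push_cast at h
    have hodd : (∑ h ∈ radical τ F c, sgn (τ (a * h + c * F h))) = 1 := by linarith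
    rw [hodd] at hparity
    by_cases hc : c = 0
    · subst hc
      have : radical τ F 0 = Finset.univ := by ext; simp [mem_radical]
      rw [this, Finset.card_univ, hK] at hparity
      norm_num at hparity
    · rcases hF.walsh_zero_and_card_radical hK hτ hc with h | h
      · exact h.2
      · rw [h.2] at hparity
        norm_num at hparity
  · intro h1
    obtain ⟨y, hy⟩ := Finset.card_eq_one.mp h1
    have h0 := hF.zero_mem_radical (τ := τ) c
    rw [hy, Finset.mem_singleton] at h0
    rw [h, hy, Finset.sum_singleton, ← h0, mul_zero, hF.apply_zero, mul_zero, add_zero, map_zero,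
      sgn_zero]
    norm_num

/-- The set of components with trivial radical has no nonzero period: the values at nonzero points
of the Fourier transform of its indicator function do not vanish, since `96` times such a value is
congruent to `960` modulo `1024`. -/
theorem eq_zero_of_period {p : K}
    (hp : ∀ c, (radical τ F (c + p)).card = 1 ↔ (radical τ F c).card = 1) : p = 0 := by
  classical
  let b : K → ℤ := fun c => if (radical τ F c).card = 1 then 1 else 0
  have hb : ∀ c, 96 * b c = 64 - walsh τ F 0 c + if c = 0 then 960 else 0 := by
    intro c
    simp only [b]
    by_cases hc : c = 0
    · subst hc
      have h1 : radical τ F 0 = Finset.univ := by ext; simp [mem_radical]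
      have h2 : walsh τ F 0 0 = 1024 := by simp [walsh, sgn_zero, hK]
      rw [h1, h2, Finset.card_univ, hK]
      norm_num
    · rcases hF.walsh_zero_and_card_radical hK hτ hc with h | h <;> rw [h.1, h.2] <;> simp [hc]
  have hne : ∀ z, z ≠ 0 → ∑ c, b c * sgn (τ (c * z)) ≠ 0 := by
    intro z hz h0
    have h1 : ∑ c, 96 * b c * sgn (τ (c * z)) = 0 := by
      simp only [mul_assoc, ← Finset.mul_sum, h0, mul_zero]
    simp only [hb, add_mul, sub_mul, Finset.sum_add_distrib, Finset.sum_sub_distrib,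
      ← Finset.mul_sum, sum_sgn_mul hτ, sum_walsh_mul_sgn hτ, hz, if_false, ite_mul, zero_mul,
      Finset.sum_ite_eq', Finset.mem_univ, if_true, map_zero, sgn_zero, hK] at h1
    push_cast at h1
    omega
  by_contra hp0
  apply hp0
  have hsgn : ∀ z, z ≠ 0 → τ (p * z) = 0 := by
    intro z hz
    have h1 : ∑ c, b c * sgn (τ (c * z)) = (∑ c, b c * sgn (τ (c * z))) * sgn (τ (p * z)) := by
      rw [Finset.sum_mul, ← Equiv.sum_comp (Equiv.addRight p)]
      refine Finset.sum_congr rfl fun c _ => ?_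
      have : b (c + p) = b c := if_congr (hp c) rfl rfl
      rw [Equiv.coe_addRight, this, add_mul, map_add, sgn_add, mul_assoc]
    rw [← sgn_eq_one_iff]
    exact (mul_left_cancel₀ (hne z hz) (by rw [mul_one]; exact h1)).symm
  exfalso
  apply hτ
  ext x
  by_cases hx : x = 0
  · simp [hx]
  · have h1 := hsgn (x / p) (div_ne_zero hx hp0)
    rw [mul_div_cancel₀ x hp0] at h1
    simpa using h1

/-- The images of `polarForm F x` and `polarForm F y` coincide only if `y` is an `F_4`-multiple of
`x`: both points lie in the radical of the component that vanishes on the image, and this radical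
has four elements. -/
theorem eq_of_range_polarForm_eq {x y : K} (hx : x ≠ 0) (hy : y ≠ 0)
    (h : Set.range (polarForm F x) = Set.range (polarForm F y)) :
    y = x ∨ y = w * x ∨ y = w ^ 2 * x := by
  classical
  have h2 := hF.card_filter_mem_radical hτ hx
  obtain ⟨c, hc, hc0⟩ := Finset.exists_mem_ne (by rw [h2]; norm_num) (0 : K)
  have hxc : x ∈ radical τ F c := (Finset.mem_filter.mp hc).2
  have hyc : y ∈ radical τ F c := by
    rw [mem_radical] at hxc ⊢
    intro z
    obtain ⟨z', hz'⟩ : polarForm F y z ∈ Set.range (polarForm F x) := by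
      rw [h]
      exact ⟨z, rfl⟩
    rw [← hz', hxc]
  have hwx := hF.mul_mem_radical hxc
  have hwwx := hF.mul_mem_radical hwx
  have h0 := hF.zero_mem_radical (τ := τ) c
  rw [← mul_assoc, ← sq] at hwwx
  have hw0 := hF.w_ne_zero
  have hw1 := hF.w_ne_one
  have hsub : ({0, x, w * x, w ^ 2 * x} : Finset K) ⊆ radical τ F c := by
    intro z hz
    simp only [Finset.mem_insert, Finset.mem_singleton] at hz
    rcases hz with rfl | rfl | rfl | rfl <;> assumption
  have hcard : ({0, x, w * x, w ^ 2 * x} : Finset K).card = 4 := by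
    have e1 : x ≠ w * x := fun h => hw1 (mul_right_cancel₀ hx (by rw [← h, one_mul]))
    have e2 : x ≠ w ^ 2 * x := fun h => by
      have : w ^ 2 = 1 := mul_right_cancel₀ hx (by rw [← h, one_mul])
      exact hw0 (by linear_combination this - hF.w_sq)
    have e3 : w * x ≠ w ^ 2 * x := fun h => by
      have : w = w ^ 2 := mul_right_cancel₀ hx h
      exact one_ne_zero (α := K) (by linear_combination -this - hF.w_sq)
    rw [Finset.card_insert_of_notMem, Finset.card_insert_of_notMem, Finset.card_insert_of_notMem,
      Finset.card_singleton]
    · simpa using e3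
    · simp [e1, e2, -right_eq_mul₀, -mul_eq_right₀]
    · simp [hx.symm, hx, hw0]
  have hrad : (radical τ F c).card = 4 := by
    have hle := Finset.card_le_card hsub
    rcases hF.walsh_zero_and_card_radical hK hτ hc0 with h | h
    · omega
    · exact h.2
  rw [← Finset.eq_of_subset_of_card_le hsub (by rw [hcard, hrad])] at hyc
  simpa [hy] using hyc

end IsTriplicateAPN

/-! ### The graph and its automorphisms -/

section Duality

/-- There is a nonzero additive form `τ`, namely the absolute trace, such that every additive form
is a multiple `τ (c x)` of it. -/
theorem exists_dual_form (K : Type*) [Field K] [CharP K 2] [Fintype K] :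
    ∃ τ : K →+ ZMod 2, τ ≠ 0 ∧ ∀ η : K →+ ZMod 2, ∃ c, ∀ x, η x = τ (c * x) := by
  let := ZMod.algebra K 2
  have hnd := traceForm_nondegenerate (ZMod 2) K
  refine ⟨(Algebra.trace (ZMod 2) K).toAddMonoidHom, ?_, fun η => ?_⟩
  · intro h
    refine Algebra.trace_ne_zero (ZMod 2) K (LinearMap.ext fun x => ?_)
    exact DFunLike.congr_fun h x
  · refine ⟨((Algebra.traceForm (ZMod 2) K).toDual hnd).symm (η.toZModLinearMap 2), fun x => ?_⟩
    have := LinearMap.BilinForm.apply_toDual_symm_apply (B := Algebra.traceForm (ZMod 2) K)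
      (hB := hnd) (η.toZModLinearMap 2) x
    rw [Algebra.traceForm_apply] at this
    exact this.symm

end Duality

section PairForm

variable {K : Type*} [Field K]

/-- The form `τ (a x + c y)` on `K × K`. -/
def pairForm (τ : K →+ ZMod 2) (a c : K) : K × K →+ ZMod 2 where
  toFun p := τ (a * p.1 + c * p.2)
  map_zero' := by simp
  map_add' p q := by rw [← map_add]; congr 1; simp only [Prod.fst_add, Prod.snd_add]; ring

theorem pairForm_add (τ : K →+ ZMod 2) (a c a' c' : K) :
    pairForm τ a c + pairForm τ a' c' = pairForm τ (a + a') (c + c') := by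
  ext p
  change τ _ + τ _ = τ _
  rw [← map_add]
  congr 1
  ring

theorem exists_eq_pairForm {τ : K →+ ZMod 2}
    (hdual : ∀ η : K →+ ZMod 2, ∃ c, ∀ x, η x = τ (c * x)) (η : K × K →+ ZMod 2) :
    ∃ a c, η = pairForm τ a c := by
  obtain ⟨a, ha⟩ := hdual (η.comp (AddMonoidHom.inl K K))
  obtain ⟨c, hc⟩ := hdual (η.comp (AddMonoidHom.inr K K))
  refine ⟨a, c, AddMonoidHom.ext fun p => ?_⟩
  change η p = τ _
  rw [map_add, ← ha, ← hc]
  simp only [AddMonoidHom.comp_apply, AddMonoidHom.inl_apply, AddMonoidHom.inr_apply, ← map_add,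
    Prod.mk_add_mk, add_zero, zero_add]

end PairForm

section Graph

variable {K : Type*} [Field K] [Fintype K]

/-- The Fourier transform of the graph of `F` at an additive form `η` on `K × K`. -/
def graphSum (F : K → K) (η : K × K →+ ZMod 2) : ℤ := ∑ x, sgn (η (x, F x))

/-- Adding the form `η` does not change whether the square of the Fourier transform of the graph
of `F` equals `1024`. -/
def IsPeriod (F : K → K) (η : K × K →+ ZMod 2) : Prop :=
  ∀ ξ : K × K →+ ZMod 2, graphSum F (ξ + η) ^ 2 = 1024 ↔ graphSum F ξ ^ 2 = 1024

theorem graphSum_pairForm (F : K → K) (τ : K →+ ZMod 2) (a c : K) :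
    graphSum F (pairForm τ a c) = walsh τ F a c := rfl

namespace IsTriplicateAPN

variable [CharP K 2] {w : K} {F : K → K} (hF : IsTriplicateAPN w F)
  (hK : Fintype.card K = 1024)
include hF hK

/-- The forms vanishing on `{0} × K` are intrinsic to the graph. -/
theorem isPeriod_pairForm_iff {τ : K →+ ZMod 2} (hτ : τ ≠ 0)
    (hdual : ∀ η : K →+ ZMod 2, ∃ c, ∀ x, η x = τ (c * x)) (a c : K) :
    IsPeriod F (pairForm τ a c) ↔ c = 0 := by
  constructor
  · intro h
    refine hF.eq_zero_of_period hK hτ fun b => ?_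
    have := h (pairForm τ 0 b)
    rwa [pairForm_add, graphSum_pairForm, graphSum_pairForm, hF.walsh_sq_eq_iff hK hτ,
      hF.walsh_sq_eq_iff hK hτ] at this
  · rintro rfl ξ
    obtain ⟨a', c', rfl⟩ := exists_eq_pairForm hdual ξ
    rw [pairForm_add, graphSum_pairForm, graphSum_pairForm, hF.walsh_sq_eq_iff hK hτ,
      hF.walsh_sq_eq_iff hK hτ, add_zero]

/-- Automorphisms of the graph preserve `{0} × K`. -/
theorem fst_eq_zero_of_graph_map (M : (K × K) ≃+ (K × K))
    (hM : ∀ x, ∃ z, M (x, F x) = (z, F z)) (y : K) : (M (0, y)).1 = 0 := by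
  obtain ⟨τ, hτ, hdual⟩ := exists_dual_form K
  choose φ hφ using hM
  have hinj : Function.Injective φ := fun x y h => by
    have : M (x, F x) = M (y, F y) := by rw [hφ, hφ, h]
    exact congrArg Prod.fst (M.injective this)
  have hsum : ∀ η : K × K →+ ZMod 2, graphSum F (η.comp M.toAddMonoidHom) = graphSum F η := by
    intro η
    refine Eq.trans ?_ (Equiv.sum_comp (Equiv.ofBijective φ
      (Finite.injective_iff_bijective.mp hinj)) fun x => sgn (η (x, F x)))
    refine Finset.sum_congr rfl fun x _ => ?_
    change sgn (η (M (x, F x))) = _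
    rw [hφ]
    rfl
  have hper : ∀ a, IsPeriod F ((pairForm τ a 0).comp M.toAddMonoidHom) := by
    intro a ξ
    have h1 : ξ = (ξ.comp M.symm.toAddMonoidHom).comp M.toAddMonoidHom := by
      refine AddMonoidHom.ext fun p => ?_
      change ξ p = ξ (M.symm (M p))
      rw [M.symm_apply_apply]
    rw [h1, ← AddMonoidHom.add_comp, hsum, hsum]
    exact (hF.isPeriod_pairForm_iff hK hτ hdual a 0).mpr rfl _
  by_contra hne
  apply hτ
  ext x
  have h1 := hper (x / (M (0, y)).1)
  obtain ⟨a, c, hac⟩ := exists_eq_pairForm hdual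
    ((pairForm τ (x / (M (0, y)).1) 0).comp M.toAddMonoidHom)
  rw [hac] at h1
  have hc := (hF.isPeriod_pairForm_iff hK hτ hdual a c).mp h1
  have h2 := DFunLike.congr_fun hac (0, y)
  change τ (x / (M (0, y)).1 * (M (0, y)).1 + 0 * (M (0, y)).2) = τ (a * 0 + c * y) at h2
  rw [div_mul_cancel₀ _ hne, hc, zero_mul, mul_zero, zero_mul, add_zero, add_zero, map_zero] at h2
  exact h2

end IsTriplicateAPN

end Graph

/-! ### Power functions in the CCZ class -/

namespace IsTriplicateAPN

variable {K : Type*} [Field K] [CharP K 2] {w : K} {F : K → K} (hF : IsTriplicateAPN w F)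
include hF

theorem exists_map_add_ne : ∃ x y, F (x + y) ≠ F x + F y := by
  by_contra! h
  have h1 : polarForm F 1 w = 0 := by
    unfold polarForm
    rw [h, add_assoc, CharTwo.add_self_eq_zero]
  rcases hF.apn 1 w one_ne_zero h1 with h | h
  · exact hF.w_ne_zero h
  · exact hF.w_ne_one h

/-- Composition of the given affine equivalence with one of the automorphisms
`(x, y) ↦ (x + a, y + F a + B a x)` of the graph of `F` gives a linear equivalence `Λ`. -/
theorem exists_linear_graph_map {d : ℕ} (h : CCZEquivalent F (fun x : K => x ^ d)) :
    ∃ Λ : (K × K) ≃+ (K × K),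
      (∀ x, ∃ z, Λ (x, x ^ d) = (z, F z)) ∧ ∀ z, ∃ x, Λ (x, x ^ d) = (z, F z) := by
  obtain ⟨L, g, hL⟩ := h
  have h2 : ∀ p : K × K, p + p = 0 := fun p =>
    Prod.ext (CharTwo.add_self_eq_zero _) (CharTwo.add_self_eq_zero _)
  have hto : ∀ z, ∃ x, L (z, F z) = (x, x ^ d) + g := by
    intro z
    obtain ⟨⟨x, y⟩, hxy, hp⟩ : L (z, F z) ∈ (fun p => p + g) '' {p : K × K | p.2 = p.1 ^ d} := by
      rw [← hL]; exact ⟨_, rfl, rfl⟩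
    obtain rfl : y = x ^ d := hxy
    exact ⟨x, hp.symm⟩
  have hfrom : ∀ x, ∃ z, L (z, F z) = (x, x ^ d) + g := by
    intro x
    obtain ⟨⟨z, y⟩, hzy, hp⟩ : (x, x ^ d) + g ∈ L '' {p : K × K | p.2 = F p.1} := by
      rw [hL]; exact ⟨_, rfl, rfl⟩
    obtain rfl : y = F z := hzy
    exact ⟨z, hp⟩
  have hd : d ≠ 0 := by
    rintro rfl
    obtain ⟨x, y, hxy⟩ := hF.exists_map_add_ne
    obtain ⟨x1, h1⟩ := hto x
    obtain ⟨x2, h2'⟩ := hto y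
    obtain ⟨x3, h3⟩ := hto 0
    obtain ⟨z, hz⟩ := hfrom (x1 + x2 + x3)
    apply hxy
    have : L (z, F z) = L (x + y, F x + F y) := by
      have e : (x + y, F x + F y) = (x, F x) + (y, F y) + (0, F 0) := by
        rw [hF.apply_zero]; simp
      rw [e, map_add, map_add, h1, h2', h3, hz]
      have := h2 g
      have h1' : (1 : K) + 1 = 0 := CharTwo.add_self_eq_zero 1
      simp only [pow_zero]
      calc (x1 + x2 + x3, (1 : K)) + g = (x1 + x2 + x3, 1 + (1 + 1)) + (g + (g + g)) := by
            rw [this, h1', add_zero, add_zero]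
        _ = (x1, 1) + (x2, 1) + (x3, 1) + (g + (g + g)) := by
            simp only [Prod.mk_add_mk]; rw [add_assoc 1 1 1]
        _ = _ := by abel
    have := L.injective this
    rw [Prod.mk.injEq] at this
    rw [← this.1, this.2]
  obtain ⟨a, ha⟩ := hfrom 0
  rw [zero_pow hd, ← Prod.zero_eq_mk, zero_add] at ha
  let S : (K × K) ≃+ (K × K) :=
    { toFun := fun p => (p.1, p.2 + polarForm F a p.1)
      invFun := fun p => (p.1, p.2 + polarForm F a p.1)
      left_inv := fun p => by
        simp only [add_assoc, CharTwo.add_self_eq_zero, add_zero]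
      right_inv := fun p => by
        simp only [add_assoc, CharTwo.add_self_eq_zero, add_zero]
      map_add' := fun p q => by
        simp only [Prod.fst_add, Prod.snd_add, hF.polar_add, Prod.mk_add_mk]
        congr 1
        ring }
  have key : ∀ x z, L (z, F z) = (x, x ^ d) + g → S (L.symm (x, x ^ d)) = (z + a, F (z + a)) := by
    intro x z hz
    have h1 : L.symm (x, x ^ d) = (z, F z) + (a, F a) := by
      rw [AddEquiv.symm_apply_eq, map_add, hz, ha, add_assoc, h2, add_zero]
    rw [h1]
    change (z + a, F z + F a + polarForm F a (z + a)) = _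
    rw [hF.polar_add, hF.polar_self, add_zero, add_polarForm F z a, polarForm_comm F a z]
  refine ⟨L.symm.trans S, fun x => ?_, fun z => ?_⟩
  · obtain ⟨z, hz⟩ := hfrom x
    exact ⟨z + a, key x z hz⟩
  · obtain ⟨x, hx⟩ := hto (z + a)
    refine ⟨x, ?_⟩
    have := key x _ hx
    rw [add_assoc, CharTwo.add_self_eq_zero, add_zero] at this
    exact this

variable [Fintype K] (hK : Fintype.card K = 1024)
include hK

/-- A function in the CCZ class of a power function arises from a power function by
composition with linear permutations on both sides and addition of a linear map. Indeed, the
preimage of `{0} × K` is invariant under all maps `(x, y) ↦ (t x, t ^ d y)`, which leaves only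
`{0} × K` and `K × {0}`; in the second case the power function is replaced by its inverse. -/
theorem exists_linear_normal_form {d : ℕ} (h : CCZEquivalent F (fun x : K => x ^ d)) :
    ∃ (L E E' : K →+ K) (e : ℕ), Function.Bijective L ∧ Function.Injective E' ∧
      ∀ x, F (L x) = E x + E' (x ^ e) := by
  obtain ⟨Λ, hΛ, hΛ'⟩ := hF.exists_linear_graph_map h
  let A : K →+ K := (AddMonoidHom.fst K K).comp (Λ.toAddMonoidHom.comp (AddMonoidHom.inl K K))
  let A' : K →+ K := (AddMonoidHom.fst K K).comp (Λ.toAddMonoidHom.comp (AddMonoidHom.inr K K))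
  let E₁ : K →+ K := (AddMonoidHom.snd K K).comp (Λ.toAddMonoidHom.comp (AddMonoidHom.inl K K))
  let E₀ : K →+ K := (AddMonoidHom.snd K K).comp (Λ.toAddMonoidHom.comp (AddMonoidHom.inr K K))
  have hsplit : ∀ x y, Λ (x, y) = (A x + A' y, E₁ x + E₀ y) := by
    intro x y
    have : ((x, y) : K × K) = (x, 0) + (0, y) := by simp
    rw [this, map_add]
    rfl
  have hFx : ∀ x, F (A x + A' (x ^ d)) = E₁ x + E₀ (x ^ d) := by
    intro x
    obtain ⟨z, hz⟩ := hΛ x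
    rw [hsplit, Prod.mk.injEq] at hz
    rw [hz.1, hz.2]
  have hsurj : ∀ z, ∃ x, A x + A' (x ^ d) = z := by
    intro z
    obtain ⟨x, hx⟩ := hΛ' z
    rw [hsplit, Prod.mk.injEq] at hx
    exact ⟨x, hx.1⟩
  have hker : ∀ x y, Λ (x, y) = 0 → x = 0 ∧ y = 0 := by
    intro x y hxy
    have := Λ.injective (hxy.trans (map_zero Λ).symm)
    simpa using this
  have hscale : ∀ t x y, t ≠ 0 → A x + A' y = 0 → A (t * x) + A' (t ^ d * y) = 0 := by
    intro t x y ht hxy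
    let T : (K × K) ≃+ (K × K) :=
      { toFun := fun p => (t * p.1, t ^ d * p.2)
        invFun := fun p => (t⁻¹ * p.1, (t ^ d)⁻¹ * p.2)
        left_inv := fun p => by simp [ht]
        right_inv := fun p => by simp [ht]
        map_add' := fun p q => by simp [mul_add] }
    have hM := hF.fst_eq_zero_of_graph_map hK ((Λ.symm.trans T).trans Λ) (fun z => by
      obtain ⟨x, hx⟩ := hΛ' z
      obtain ⟨z', hz'⟩ := hΛ (t * x)
      refine ⟨z', ?_⟩
      change Λ (T (Λ.symm _)) = _
      rw [← hx, AddEquiv.symm_apply_apply, ← hz', mul_pow]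
      rfl) (E₁ x + E₀ y)
    change (Λ (T (Λ.symm _))).1 = 0 at hM
    have h0 : Λ.symm (0, E₁ x + E₀ y) = (x, y) := by
      rw [AddEquiv.symm_apply_eq, hsplit, hxy]
    rw [h0] at hM
    change (Λ (t * x, t ^ d * y)).1 = 0 at hM
    rwa [hsplit] at hM
  by_cases hA : Function.Injective A
  · by_cases hA' : ∀ y, A' y = 0
    · refine ⟨A, E₁, E₀, d, Finite.injective_iff_bijective.mp hA, ?_, fun x => ?_⟩
      · rw [injective_iff_map_eq_zero]
        intro y hy
        exact (hker 0 y (by rw [hsplit, hA', hy]; simp)).2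
      · rw [← hFx, hA', add_zero]
    · -- the preimage of `{0} × K` is the graph of an additive map `H` with
      -- `H (t ^ d * y) = t * H y`, which makes `t ↦ t ^ d` additive
      exfalso
      push Not at hA'
      obtain ⟨y₀, hy₀⟩ := hA'
      have hAs := (Finite.injective_iff_surjective.mp hA)
      choose H hH using fun y => hAs (A' y)
      have hHadd : ∀ y y', H (y + y') = H y + H y' := fun y y' => hA (by
        rw [map_add, hH, hH, hH, map_add])
      have hHmul : ∀ t y, t ≠ 0 → H (t ^ d * y) = t * H y := by
        intro t y ht
        apply hA
        have := hscale t (H y) y ht (by rw [hH, CharTwo.add_self_eq_zero])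
        rw [hH]
        exact (CharTwo.add_eq_zero.mp this).symm
      have hHy₀ : H y₀ ≠ 0 := fun h0 => hy₀ (by rw [← hH, h0, map_zero])
      have hd : d ≠ 0 := by
        rintro rfl
        have h1 := hHmul w y₀ hF.w_ne_zero
        rw [pow_zero, one_mul] at h1
        exact hF.w_ne_one (mul_right_cancel₀ hHy₀ (by rw [← h1, one_mul]))
      have hinj : Function.Injective fun t : K => t ^ d := by
        intro s t hst
        simp only at hst
        by_cases hs : s = 0
        · rw [hs, zero_pow hd] at hst
          rw [hs, eq_zero_of_pow_eq_zero hst.symm]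
        · have ht : t ≠ 0 := by
            rintro rfl
            rw [zero_pow hd] at hst
            exact hs (eq_zero_of_pow_eq_zero hst)
          apply mul_right_cancel₀ hHy₀
          rw [← hHmul s y₀ hs, ← hHmul t y₀ ht, hst]
      have hpow := Finite.injective_iff_surjective.mp hinj
      obtain ⟨t₀, ht₀⟩ := hpow y₀
      simp only at ht₀
      have ht₀0 : t₀ ≠ 0 := by
        rintro rfl
        rw [zero_pow hd] at ht₀
        exact hy₀ (by rw [← ht₀, map_zero])
      have hH0 : H 0 = 0 := by simpa using hHadd 0 0
      have hHpow : ∀ t, H (t ^ d) = t * (H y₀ / t₀) := by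
        intro t
        by_cases ht : t = 0
        · rw [ht, zero_pow hd, hH0, zero_mul]
        · have := hHmul (t / t₀) y₀ (div_ne_zero ht ht₀0)
          rw [div_pow, ht₀, div_mul_cancel₀ _ (ht₀ ▸ pow_ne_zero d ht₀0)] at this
          rw [this]
          ring
      have hHinj : Function.Injective H := by
        intro y y' hyy
        obtain ⟨s, rfl⟩ := hpow y
        obtain ⟨t, rfl⟩ := hpow y'
        simp only [hHpow] at hyy
        rw [mul_right_cancel₀ (div_ne_zero hHy₀ ht₀0) hyy]
      obtain ⟨z, z', hzz⟩ := hF.exists_map_add_ne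
      obtain ⟨x, rfl⟩ := hsurj z
      obtain ⟨x', rfl⟩ := hsurj z'
      apply hzz
      have hadd : (x + x') ^ d = x ^ d + x' ^ d := hHinj (by
        rw [hHadd, hHpow, hHpow, hHpow, add_mul])
      have h1 : A x + A' (x ^ d) + (A x' + A' (x' ^ d)) =
          A (x + x') + A' ((x + x') ^ d) := by
        rw [hadd, map_add, map_add]; ring
      rw [h1, hFx, hFx, hFx, hadd, map_add, map_add]
      ring
  · -- the preimage of `{0} × K` is `K × {0}`
    rw [injective_iff_map_eq_zero] at hA
    push Not at hA
    obtain ⟨x₀, hx₀, hx₀0⟩ := hA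
    have hA0 : ∀ x, A x = 0 := by
      intro x
      by_cases hx : x = 0
      · rw [hx, map_zero]
      · have := hscale (x / x₀) x₀ 0 (div_ne_zero hx hx₀0)
          (by rw [hx₀, map_zero, add_zero])
        rwa [div_mul_cancel₀ _ hx₀0, mul_zero, map_zero, add_zero] at this
    simp only [hA0, zero_add] at hFx hsurj
    have hA's : Function.Surjective A' := fun z => by
      obtain ⟨x, hx⟩ := hsurj z
      exact ⟨_, hx⟩
    have hA'b := Finite.surjective_iff_bijective.mp hA's
    have hpow : Function.Surjective fun x : K => x ^ d := fun y => by
      obtain ⟨x, hx⟩ := hsurj (A' y)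
      exact ⟨x, hA'b.1 hx⟩
    obtain ⟨e, he⟩ : ∃ e, ∀ x : K, (x ^ e) ^ d = x := by
      obtain ⟨g, hg⟩ := IsCyclic.exists_generator (α := Kˣ)
      obtain ⟨y, hy⟩ := hpow (g : K)
      simp only at hy
      have hd : d ≠ 0 := by
        rintro rfl
        obtain ⟨x, hx⟩ := hpow 0
        simp at hx
      have hy0 : y ≠ 0 := by
        rintro rfl
        rw [zero_pow hd] at hy
        exact g.ne_zero hy.symm
      obtain ⟨e, he⟩ := (mem_powers_iff_mem_zpowers (x := g)).mpr (hg (Units.mk0 y hy0))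
      have he' : (g : K) ^ e = y := by simpa using congrArg Units.val he
      refine ⟨e + 1023, fun x => ?_⟩
      by_cases hx : x = 0
      · rw [hx, zero_pow (by omega), zero_pow hd]
      · obtain ⟨m, hm⟩ := (mem_powers_iff_mem_zpowers (x := g)).mpr (hg (Units.mk0 x hx))
        have hm' : (g : K) ^ m = x := by simpa using congrArg Units.val hm
        rw [pow_add, pow_eq_one hK hx, mul_one, ← hm', ← pow_mul, ← pow_mul,
          show m * (e * d) = e * d * m by ring, pow_mul, pow_mul, he', hy]
    refine ⟨A', E₀, E₁, e, hA'b, ?_, fun x => ?_⟩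
    · rw [injective_iff_map_eq_zero]
      intro x hx
      exact (hker x 0 (by rw [hsplit, hA0, hx]; simp)).1
    · have := hFx (x ^ e)
      rw [he] at this
      rw [this, add_comm]

/-- The linear permutation of the previous lemma maps `F_4`-lines to `F_4`-lines: the partition of
`K` into the radicals of the components of a quadratic power function is invariant under
multiplication, so that the class of `1` is the multiplicative group of `F_4`. -/
theorem semilinear_of_normal_form {L E E' : K →+ K} {e : ℕ} (hL : Function.Bijective L)
    (hE' : Function.Injective E') (h : ∀ x, F (L x) = E x + E' (x ^ e)) :
    (∀ x, L (w * x) = w * L x) ∨ ∀ x, L (w * x) = w ^ 2 * L x := by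
  obtain ⟨τ, hτ, -⟩ := exists_dual_form K
  let P : K → K → K := polarForm fun x => x ^ e
  have hP : ∀ x y, polarForm F (L x) (L y) = E' (P x y) := by
    intro x y
    simp only [polarForm, P]
    rw [← map_add, h, h, h, map_add, map_add, map_add]
    linear_combination (E x + E y) * CharTwo.two_eq_zero (R := K)
  have hPmul : ∀ t x, t ≠ 0 → Set.range (P (t * x)) = (t ^ e * ·) '' Set.range (P x) := by
    intro t x ht
    have h1 : ∀ y, P (t * x) (t * y) = t ^ e * P x y := fun y => by
      simp only [P, polarForm]
      rw [← mul_add, mul_pow, mul_pow, mul_pow]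
      ring
    ext z
    constructor
    · rintro ⟨y, rfl⟩
      exact ⟨_, ⟨t⁻¹ * y, rfl⟩, by simp only; rw [← h1, mul_inv_cancel_left₀ ht]⟩
    · rintro ⟨_, ⟨y, rfl⟩, rfl⟩
      exact ⟨t * y, h1 y⟩
  have hrange : ∀ x, Set.range (polarForm F (L x)) = E' '' Set.range (P x) := by
    intro x
    rw [← Set.range_comp, ← hL.2.range_comp (polarForm F (L x))]
    exact congrArg Set.range (funext fun y => hP x y)
  have hw0 := hF.w_ne_zero
  have hw1 := hF.w_ne_one
  have hL0 : ∀ x, x ≠ 0 → L x ≠ 0 := fun x hx h0 =>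
    hx (hL.1 (by rw [h0, map_zero]))
  have hiff : ∀ x y, x ≠ 0 → y ≠ 0 → Set.range (P x) = Set.range (P y) →
      L y = L x ∨ L y = w * L x ∨ L y = w ^ 2 * L x := by
    intro x y hx hy hxy
    exact hF.eq_of_range_polarForm_eq hK hτ (hL0 x hx) (hL0 y hy) (by rw [hrange, hrange, hxy])
  obtain ⟨g, hg⟩ := hL.2 (w * L 1)
  have hL1 := hL0 1 one_ne_zero
  have hg0 : g ≠ 0 := by
    rintro rfl
    rw [map_zero] at hg
    exact mul_ne_zero hw0 hL1 hg.symm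
  have hg1 : g ≠ 1 := by
    rintro rfl
    exact hw1 (mul_right_cancel₀ hL1 (by rw [← hg, one_mul]))
  have hRg : Set.range (P g) = Set.range (P 1) := by
    apply hE'.image_injective
    rw [← hrange, ← hrange, hg, hF.range_polarForm_mul]
  have hRmul : ∀ x t, t ≠ 0 → Set.range (P t) = Set.range (P 1) →
      x ≠ 0 → Set.range (P (x * t)) = Set.range (P x) := by
    intro x t _ ht hx
    rw [hPmul x t hx, ht, ← hPmul x 1 hx, mul_one]
  have hRgg := (hRmul g g hg0 hRg hg0).trans hRg
  have hgg : g ^ 2 + g + 1 = 0 := by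
    rcases hiff 1 (g * g) one_ne_zero (mul_ne_zero hg0 hg0) hRgg.symm with h1 | h1 | h1
    · exfalso
      apply hg1
      have h2 : (g + 1) ^ 2 = 0 := by
        linear_combination hL.1 h1 + (1 + g) * CharTwo.two_eq_zero (R := K)
      exact CharTwo.add_eq_zero.mp (eq_zero_of_pow_eq_zero h2)
    · exfalso
      rw [← hg] at h1
      exact hg1 (mul_right_cancel₀ hg0 (by rw [hL.1 h1, one_mul]))
    · have h2 : L (g * g) = L (g + 1) := by
        rw [h1, map_add, hg, hF.w_sq]
        ring
      linear_combination hL.1 h2 + (g + 1) * CharTwo.two_eq_zero (R := K)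
  have hRw : Set.range (P w) = Set.range (P 1) := by
    have h1 : (g - w) * (g - w ^ 2) = 0 := by
      linear_combination hgg - (g - w + 1) * hF.root
    rcases mul_eq_zero.mp h1 with h1 | h1
    · rw [← sub_eq_zero.mp h1, hRg]
    · have h2 : w = g * g := by
        rw [sub_eq_zero.mp h1]
        linear_combination -w * hF.w_cube
      rw [h2, hRgg]
  have hLw : ∀ x, L (w * x) = w * L x ∨ L (w * x) = w ^ 2 * L x := by
    intro x
    by_cases hx : x = 0
    · simp [hx]
    · have h1 := hRmul x w hw0 hRw hx
      rw [mul_comm] at h1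
      rcases hiff x (w * x) hx (mul_ne_zero hw0 hx) h1.symm with h2 | h2
      · exact absurd (mul_right_cancel₀ hx (by rw [hL.1 h2, one_mul])) hw1
      · exact h2
  -- a group is not the union of two proper subgroups
  by_contra! hne
  obtain ⟨⟨x, hx⟩, y, hy⟩ := hne
  have hx' := (hLw x).resolve_left hx
  have hy' := (hLw y).resolve_right hy
  rcases hLw (x + y) with h1 | h1
  · rw [mul_add, map_add, hy', map_add, mul_add] at h1
    exact hx (add_right_cancel h1)
  · rw [mul_add, map_add, hx', map_add, mul_add] at h1
    exact hy (add_left_cancel h1)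

end IsTriplicateAPN

/-! ### Coefficients of functions on the field -/

section Coefficients

variable {K : Type*} [Field K] [Fintype K]

open Classical in
/-- The coefficient of `x ^ n`, up to sign and for `n` modulo `1023`, of a function on the field
`K` with `1024` elements; here `x ^ (1022 * n)` is the inverse of `x ^ n`. -/
noncomputable def coeffAt (n : ℕ) (f : K → K) : K := ∑ x : Kˣ, f x * (x : K) ^ (1022 * n)

theorem coeffAt_add (n : ℕ) (f g : K → K) :
    coeffAt n (fun x => f x + g x) = coeffAt n f + coeffAt n g := by
  simp only [coeffAt, add_mul, Finset.sum_add_distrib]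

theorem coeffAt_sum {ι : Type*} (s : Finset ι) (n : ℕ) (f : ι → K → K) :
    coeffAt n (fun x => ∑ i ∈ s, f i x) = ∑ i ∈ s, coeffAt n (f i) := by
  simp only [coeffAt, Finset.sum_mul]
  exact Finset.sum_comm

theorem coeffAt_mul_pow [CharP K 2] (hK : Fintype.card K = 1024) (n m : ℕ) (c : K) :
    coeffAt n (fun x => c * x ^ m) = if 1023 ∣ m + 1022 * n then c else 0 := by
  classical
  have h := FiniteField.sum_pow_units K (m + 1022 * n)
  rw [hK, CharTwo.neg_eq] at h
  simp only [coeffAt, mul_assoc, ← pow_add, ← Finset.mul_sum, h]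
  simp

/-- Every additive map is given by a linearized polynomial: the powers of the Frobenius
automorphism are linearly independent over `K`, and their number is the dimension of the space of
additive maps. -/
theorem exists_linearized [CharP K 2] (hK : Fintype.card K = 1024) (L : K →+ K) :
    ∃ a : Fin 10 → K, ∀ x, L x = ∑ m, a m * x ^ 2 ^ (m : ℕ) := by
  let := ZMod.algebra K 2
  have hdim : Module.finrank (ZMod 2) K = 10 := by
    have h := Module.card_eq_pow_finrank (K := ZMod 2) (V := K)
    rw [hK, ZMod.card] at h
    exact (Nat.pow_right_injective le_rfl (by simpa using h)).symm
  let v : Fin 10 → K →ₗ[ZMod 2] K := fun m =>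
    (FiniteField.frobeniusAlgHom (ZMod 2) K ^ (m : ℕ)).toLinearMap
  have hinj : Function.Injective fun m : Fin 10 =>
      FiniteField.frobeniusAlgHom (ZMod 2) K ^ (m : ℕ) := by
    intro i j hij
    have hi : (i : ℕ) < Module.finrank (ZMod 2) K := by rw [hdim]; exact i.2
    have hj : (j : ℕ) < Module.finrank (ZMod 2) K := by rw [hdim]; exact j.2
    have := (FiniteField.bijective_frobeniusAlgHom_pow (ZMod 2) K).1
      (a₁ := ⟨i, hi⟩) (a₂ := ⟨j, hj⟩) hij
    exact Fin.ext (Fin.mk.inj_iff.mp this)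
  have hli : LinearIndependent K v := (linearIndependent_toLinearMap (ZMod 2) K K).comp _ hinj
  have hspan := hli.span_eq_top_of_card_eq_finrank' (by
    rw [Fintype.card_fin, Module.finrank_linearMap_self, hdim])
  have hmem : L.toZModLinearMap 2 ∈ Submodule.span K (Set.range v) := by rw [hspan]; trivial
  obtain ⟨a, ha⟩ := (Submodule.mem_span_range_iff_exists_fun K).mp hmem
  refine ⟨a, fun x => ?_⟩
  have h := (LinearMap.congr_fun ha x).symm
  change L x = _ at h
  rw [h, LinearMap.sum_apply]
  refine Finset.sum_congr rfl fun m _ => ?_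
  rw [LinearMap.smul_apply, smul_eq_mul]
  congr 1
  change (FiniteField.frobeniusAlgHom (ZMod 2) K ^ (m : ℕ)) x = _
  rw [AlgHom.coe_pow]
  induction (m : ℕ) with
  | zero => simp
  | succ k ih =>
    rw [Function.iterate_succ_apply', ih, FiniteField.frobeniusAlgHom_apply, ZMod.card, ← pow_mul,
      pow_succ]

end Coefficients

section NoNormalForm

variable {K : Type*} [Field K] [CharP K 2] [Fintype K] (hK : Fintype.card K = 1024)
include hK

/-- The coefficient of `x ^ (2 * 4 ^ l + 4 ^ m)` in the composition of `x ^ 3 + u x ^ 36` with a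
polynomial that is linearized over `F_4`. Indices are modulo `5` as `x ^ (4 ^ 5) = x`. -/
theorem coeffAt_cubicBinomial (u : K) (a : Fin 5 → K) (l m : Fin 5) :
    coeffAt (2 * 4 ^ (l : ℕ) + 4 ^ (m : ℕ))
      (fun x => cubicBinomial u (∑ i, a i * x ^ 4 ^ (i : ℕ))) =
      a l ^ 2 * a m + u * a (l + 3) ^ 32 * a (m + 4) ^ 4 := by
  have hexp : ∀ x : K, cubicBinomial u (∑ i, a i * x ^ 4 ^ (i : ℕ)) =
      (∑ i : Fin 5, ∑ j : Fin 5, a i ^ 2 * a j * x ^ (2 * 4 ^ (i : ℕ) + 4 ^ (j : ℕ))) +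
      ∑ i : Fin 5, ∑ j : Fin 5,
        u * a i ^ 32 * a j ^ 4 * x ^ (32 * 4 ^ (i : ℕ) + 4 * 4 ^ (j : ℕ)) := by
    intro x
    have hp : ∀ k : ℕ, (∑ i, a i * x ^ 4 ^ (i : ℕ)) ^ 2 ^ k =
        ∑ i, (a i * x ^ 4 ^ (i : ℕ)) ^ 2 ^ k := fun k => sum_pow_char_pow 2 k _ _
    have h1 := hp 1
    have h2 := hp 2
    have h5 := hp 5
    norm_num at h1 h2 h5
    have hc : ∀ y : K, cubicBinomial u y = y ^ 2 * y + u * (y ^ 32 * y ^ 4) := fun y => by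
      unfold cubicBinomial; ring
    rw [hc, h1, h2, h5, Finset.sum_mul_sum, Finset.sum_mul_sum, Finset.mul_sum]
    congr 1
    · refine Finset.sum_congr rfl fun i _ => Finset.sum_congr rfl fun j _ => ?_
      ring
    · refine Finset.sum_congr rfl fun i _ => ?_
      rw [Finset.mul_sum]
      refine Finset.sum_congr rfl fun j _ => ?_
      ring
  have hiff1 : ∀ l m i j : Fin 5, 1023 ∣ 2 * 4 ^ (i : ℕ) + 4 ^ (j : ℕ) +
      1022 * (2 * 4 ^ (l : ℕ) + 4 ^ (m : ℕ)) ↔ i = l ∧ j = m := by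
    decide +kernel
  have hiff2 : ∀ l m i j : Fin 5, 1023 ∣ 32 * 4 ^ (i : ℕ) + 4 * 4 ^ (j : ℕ) +
      1022 * (2 * 4 ^ (l : ℕ) + 4 ^ (m : ℕ)) ↔ i = l + 3 ∧ j = m + 4 := by
    decide +kernel
  simp only [hexp, coeffAt_add, coeffAt_sum, coeffAt_mul_pow hK, hiff1, hiff2, ite_and]
  simp

omit [CharP K 2] in
/-- Multiplying the equations in question over all indices gives `Q ^ 3 = u ^ 5 * Q ^ 36` for the
product `Q` of all coefficients. -/
theorem pow_eq_one_of_prod {u Q : K} (hQ : Q ≠ 0) (h : Q ^ 3 = u ^ 5 * Q ^ 36) : u ^ 155 = 1 := by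
  have h1 : u ^ 5 * Q ^ 33 = 1 := by
    apply mul_right_cancel₀ (pow_ne_zero 3 hQ)
    linear_combination -h
  calc u ^ 155 = u ^ 155 * Q ^ 1023 := by rw [pow_eq_one hK hQ, mul_one]
    _ = (u ^ 5 * Q ^ 33) ^ 31 := by ring
    _ = 1 := by rw [h1, one_pow]

/-- The exponents here are `3 * 4 ^ l`. -/
theorem exists_coeff_three_ne_zero {u : K} (hu : u ^ 155 ≠ 1) {a : Fin 5 → K} (ha : a ≠ 0) :
    ∃ l, a l ^ 2 * a l + u * a (l + 3) ^ 32 * a (l + 4) ^ 4 ≠ 0 := by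
  by_contra! h
  have hstep : ∀ l, a l ≠ 0 → a (l + 4) ≠ 0 := by
    intro l hl h0
    have := h l
    rw [h0] at this
    exact hl (eq_zero_of_pow_eq_zero (n := 3) (by linear_combination this))
  obtain ⟨l, hl⟩ := Function.ne_iff.mp ha
  have hall : ∀ m, a m ≠ 0 := by
    have h1 := hstep _ hl
    have h2 := hstep _ h1
    have h3 := hstep _ h2
    have h4 := hstep _ h3
    intro m
    have hm : ∀ l m : Fin 5, m = l ∨ m = l + 4 ∨ m = l + 4 + 4 ∨ m = l + 4 + 4 + 4 ∨
      m = l + 4 + 4 + 4 + 4 := by decide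
    rcases hm l m with rfl | rfl | rfl | rfl | rfl <;> assumption
  refine hu (pow_eq_one_of_prod hK (Q := a 0 * a 1 * a 2 * a 3 * a 4)
    (by simp [hall]) ?_)
  have e : ∀ l, a l ^ 3 = u * a (l + 3) ^ 32 * a (l + 4) ^ 4 := fun l => by
    linear_combination h l - u * a (l + 3) ^ 32 * a (l + 4) ^ 4 * CharTwo.two_eq_zero (R := K)
  calc _ = a 0 ^ 3 * a 1 ^ 3 * a 2 ^ 3 * a 3 ^ 3 * a 4 ^ 3 := by ring
    _ = (u * a 3 ^ 32 * a 4 ^ 4) * (u * a 4 ^ 32 * a 0 ^ 4) * (u * a 0 ^ 32 * a 1 ^ 4) *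
        (u * a 1 ^ 32 * a 2 ^ 4) * (u * a 2 ^ 32 * a 3 ^ 4) := by
      rw [e 0, e 1, e 2, e 3, e 4]; rfl
    _ = _ := by ring

/-- The exponents here are `2 * 4 ^ l + 4 ^ (l + 4)`, that is, `9 * 2 ^ (2 * l + 8)` modulo `1023`. -/
theorem exists_coeff_nine_ne_zero {u : K} (hu0 : u ≠ 0) (hu : u ^ 155 ≠ 1) {a : Fin 5 → K}
    (ha : a ≠ 0) :
    ∃ l, a l ^ 2 * a (l + 4) + u * a (l + 3) ^ 32 * a (l + 4 + 4) ^ 4 ≠ 0 := by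
  by_contra! h
  have e : ∀ l, a l ^ 2 * a (l + 4) = u * a (l + 3) ^ 32 * a (l + 4 + 4) ^ 4 := fun l => by
    linear_combination h l - u * a (l + 3) ^ 32 * a (l + 4 + 4) ^ 4 * CharTwo.two_eq_zero (R := K)
  have hstep : ∀ l, a (l + 3) ≠ 0 → a (l + 4) ≠ 0 := by
    intro l hl h0
    have hll : ∀ l : Fin 5, l + 4 + 4 = l + 3 := by decide
    have := e l
    rw [h0, hll, mul_zero] at this
    have h36 : u * a (l + 3) ^ 32 * a (l + 3) ^ 4 ≠ 0 := by simp [hu0, hl]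
    exact h36 this.symm
  obtain ⟨l, hl⟩ := Function.ne_iff.mp ha
  have hstep' : ∀ l, a l ≠ 0 → a (l + 1) ≠ 0 := by
    intro l hl
    have h23 : ∀ l : Fin 5, l + 2 + 3 = l := by decide
    have h24 : ∀ l : Fin 5, l + 2 + 4 = l + 1 := by decide
    have := hstep (l + 2) (by rwa [h23])
    rwa [h24] at this
  have hall : ∀ m, a m ≠ 0 := by
    have h1 := hstep' _ hl
    have h2 := hstep' _ h1
    have h3 := hstep' _ h2
    have h4 := hstep' _ h3
    intro m
    have hm : ∀ l m : Fin 5, m = l ∨ m = l + 1 ∨ m = l + 1 + 1 ∨ m = l + 1 + 1 + 1 ∨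
      m = l + 1 + 1 + 1 + 1 := by decide
    rcases hm l m with rfl | rfl | rfl | rfl | rfl <;> assumption
  refine hu (pow_eq_one_of_prod hK (Q := a 0 * a 1 * a 2 * a 3 * a 4)
    (by simp [hall]) ?_)
  calc _ = (a 0 ^ 2 * a 4) * (a 1 ^ 2 * a 0) * (a 2 ^ 2 * a 1) * (a 3 ^ 2 * a 2) *
        (a 4 ^ 2 * a 3) := by ring
    _ = (u * a 3 ^ 32 * a 3 ^ 4) * (u * a 4 ^ 32 * a 4 ^ 4) * (u * a 0 ^ 32 * a 0 ^ 4) *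
        (u * a 1 ^ 32 * a 1 ^ 4) * (u * a 2 ^ 32 * a 2 ^ 4) := by
      exact congrArg₂ _ (congrArg₂ _ (congrArg₂ _ (congrArg₂ _ (e 0) (e 1)) (e 2)) (e 3)) (e 4)
    _ = _ := by ring

/-- Additive maps have exponents `2 ^ m`; hence only the exponents `2 ^ m` and `e * 2 ^ m`, modulo
`1023`, occur in `E x + E' (x ^ e)`. -/
theorem exists_dvd_of_coeffAt_ne_zero {E E' : K →+ K} {e n : ℕ}
    (h : coeffAt n (fun x => E x + E' (x ^ e)) ≠ 0) :
    (∃ m : Fin 10, 1023 ∣ 2 ^ (m : ℕ) + 1022 * n) ∨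
      ∃ m : Fin 10, 1023 ∣ e * 2 ^ (m : ℕ) + 1022 * n := by
  by_contra! hne
  apply h
  obtain ⟨a, ha⟩ := exists_linearized hK E
  obtain ⟨b, hb⟩ := exists_linearized hK E'
  simp only [ha, hb, ← pow_mul, coeffAt_add, coeffAt_sum, coeffAt_mul_pow hK]
  simp [hne.1, hne.2]

/-- The composition of `x ^ 3 + u x ^ 36` with an `F_4`-linear map is not the sum of an additive
map and of the composition of a power function with an additive map: the exponents of the former
include some `3 * 2 ^ i` and some `9 * 2 ^ j`, while all the nonlinear exponents of the latter are
in one class of exponents modulo multiplication by `2`. -/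
theorem not_normal_form {u : K} (hu0 : u ≠ 0) (hu : u ^ 155 ≠ 1) {a : Fin 5 → K} (ha : a ≠ 0)
    (E E' : K →+ K) (e : ℕ)
    (h : ∀ x, cubicBinomial u (∑ i, a i * x ^ 4 ^ (i : ℕ)) = E x + E' (x ^ e)) : False := by
  have hlin : ∀ l k : Fin 5, ∀ m : Fin 10, ¬ 1023 ∣ 2 ^ (m : ℕ) +
      1022 * (2 * 4 ^ (l : ℕ) + 4 ^ (k : ℕ)) := by decide +kernel
  have hdvd : ∀ l k : Fin 5, a l ^ 2 * a k + u * a (l + 3) ^ 32 * a (k + 4) ^ 4 ≠ 0 →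
      ∃ m : Fin 10, 1023 ∣ e * 2 ^ (m : ℕ) + 1022 * (2 * 4 ^ (l : ℕ) + 4 ^ (k : ℕ)) := by
    intro l k hlk
    rw [← coeffAt_cubicBinomial hK, funext h] at hlk
    exact (exists_dvd_of_coeffAt_ne_zero hK hlk).resolve_left fun ⟨m, hm⟩ => hlin l k m hm
  obtain ⟨l, hl⟩ := exists_coeff_three_ne_zero hK hu ha
  obtain ⟨l', hl'⟩ := exists_coeff_nine_ne_zero hK hu0 hu ha
  obtain ⟨m, hm⟩ := hdvd _ _ hl
  obtain ⟨m', hm'⟩ := hdvd _ _ hl'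
  have hclass : ∀ l l' : Fin 5, ∀ m m' : Fin 10,
      ¬ (2 ^ (m' : ℕ) * (2 * 4 ^ (l : ℕ) + 4 ^ (l : ℕ))) % 1023 =
        (2 ^ (m : ℕ) * (2 * 4 ^ (l' : ℕ) + 4 ^ ((l' + 4 : Fin 5) : ℕ))) % 1023 := by
    decide +kernel
  apply hclass l l' m m'
  have hmod : ∀ s n : ℕ, 1023 ∣ s + 1022 * n → n ≡ s [MOD 1023] := by
    intro s n hs
    unfold Nat.ModEq
    omega
  have h1 := (hmod _ _ hm).mul_left (2 ^ (m' : ℕ))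
  have h2 := (hmod _ _ hm').mul_left (2 ^ (m : ℕ))
  refine h1.trans (Nat.ModEq.trans ?_ h2.symm)
  rw [show 2 ^ (m' : ℕ) * (e * 2 ^ (m : ℕ)) = 2 ^ (m : ℕ) * (e * 2 ^ (m' : ℕ)) by ring]

end NoNormalForm

/-! ### The characterization and the inequivalence -/

section Final

variable {K : Type*} [Field K]

theorem mem_iff_pow_eq_self [Finite K] {k : Subfield K} (hk : Nat.card k = 32) (z : K) :
    z ∈ k ↔ z ^ 32 = z := by
  classical
  have := Fintype.ofFinite K
  have := Fintype.ofFinite k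
  have hk' : Fintype.card k = 32 := by rw [← Nat.card_eq_fintype_card, hk]
  have hpow : ∀ y : k, (y : K) ^ 32 = y := fun y => by
    have := FiniteField.pow_card y
    rw [hk'] at this
    exact_mod_cast congrArg Subtype.val this
  refine ⟨fun h => hpow ⟨z, h⟩, fun hz => ?_⟩
  -- otherwise `X ^ 32 - X` would have `33` roots
  by_contra hzk
  let s : Finset K := insert z (Finset.univ.image fun y : k => (y : K))
  have hs : s.card = 33 := by
    rw [Finset.card_insert_of_notMem, Finset.card_image_of_injective _ Subtype.val_injective,
      Finset.card_univ, hk']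
    simpa using hzk
  have h0 := Polynomial.eq_zero_of_natDegree_lt_card_of_eval_eq_zero'
    (Polynomial.X ^ 32 - Polynomial.X : Polynomial K) s (by
      intro y hy
      rcases Finset.mem_insert.mp hy with rfl | hy
      · simp [hz]
      · obtain ⟨y, -, rfl⟩ := Finset.mem_image.mp hy
        simp [hpow]) (by
      rw [FiniteField.X_pow_card_sub_X_natDegree_eq K (by norm_num), hs]; norm_num)
  exact FiniteField.X_pow_card_sub_X_ne_zero K (by norm_num) h0

theorem mem_mul_subfield_iff {k : Subfield K} (hk : ∀ z, z ∈ k ↔ z ^ 32 = z) {w u : K}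
    (hw : w ^ 3 = 1) (hu : u ≠ 0) :
    u ∈ {y : K | ∃ c ∈ k, c ≠ 0 ∧ y = w * c} ↔ u ^ 31 = w := by
  have hw31 : w ^ 31 = w := by
    rw [show 31 = 3 * 10 + 1 from rfl, pow_add, pow_mul, hw, one_pow, one_mul, pow_one]
  have hw0 : w ≠ 0 := by
    rintro rfl
    simp at hw
  constructor
  · rintro ⟨c, hc, hc0, rfl⟩
    have h1 : c ^ 31 = 1 := by
      apply mul_right_cancel₀ hc0
      rw [← pow_succ, (hk c).mp hc, one_mul]
    rw [mul_pow, hw31, h1, mul_one]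
  · intro h
    refine ⟨u / w, ?_, div_ne_zero hu hw0, by field_simp⟩
    rw [hk, pow_succ, div_pow, h, hw31, div_self hw0, one_mul]

theorem sum_fin_ten {M : Type*} [AddCommMonoid M] (f : Fin 10 → M) : ∑ m, f m =
    ∑ i : Fin 5, f ⟨2 * i, by omega⟩ + ∑ i : Fin 5, f ⟨2 * i + 1, by omega⟩ := by
  simp only [Fin.sum_univ_succ, Fin.sum_univ_zero]
  change f 0 + (f 1 + (f 2 + (f 3 + (f 4 + (f 5 + (f 6 + (f 7 + (f 8 + (f 9 + 0))))))))) =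
    f 0 + (f 2 + (f 4 + (f 6 + (f 8 + 0)))) + (f 1 + (f 3 + (f 5 + (f 7 + (f 9 + 0)))))
  abel

variable [CharP K 2] [Fintype K] (hK : Fintype.card K = 1024)
include hK

theorem isTriplicateAPN_cubicBinomial {k : Subfield K} (hk : ∀ z, z ∈ k ↔ z ^ 32 = z)
    (hcard : Nat.card k = 32) {w u : K} (hw : w ^ 2 + w + 1 = 0)
    (hu : u ^ 31 = w ∨ u ^ 31 = w ^ 2) : IsTriplicateAPN w (cubicBinomial u) where
  root := hw
  apply_mul x := by
    have hw3 : w ^ 3 = 1 := by linear_combination (w - 1) * hw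
    have hw36 : w ^ 36 = 1 := by rw [show 36 = 3 * 12 from rfl, pow_mul, hw3, one_pow]
    rw [cubicBinomial, cubicBinomial, mul_pow, mul_pow, hw3, hw36, one_mul, one_mul]
  polar_add := polarForm_cubicBinomial_add u
  apn x y hx h := by
    rcases hu with hu | hu
    · exact polarForm_cubicBinomial_eq_zero hK hk hcard hw hu hx h
    · exact polarForm_cubicBinomial_eq_zero hK hk hcard
        (by linear_combination (w ^ 2 - w + 1) * hw) hu hx h

/-- A linearized polynomial that is `F_4`-linear, or semilinear, has exponents of one parity. -/
theorem coeff_linearized_eq_zero {L : K →+ K} {a : Fin 10 → K}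
    (ha : ∀ x, L x = ∑ m, a m * x ^ 2 ^ (m : ℕ)) {w t : K} (hL : ∀ x, L (w * x) = t * L x)
    (m : Fin 10) (hm : w ^ 2 ^ (m : ℕ) ≠ t) : a m = 0 := by
  have h0 : ∀ x, ∑ i, a i * (w ^ 2 ^ (i : ℕ) - t) * x ^ 2 ^ (i : ℕ) = 0 := by
    intro x
    have h := hL x
    rw [ha, ha, Finset.mul_sum, ← sub_eq_zero, ← Finset.sum_sub_distrib] at h
    rw [← h]
    refine Finset.sum_congr rfl fun i _ => ?_
    rw [mul_pow]
    ring
  have h1 : coeffAt (2 ^ (m : ℕ)) (fun x => ∑ i : Fin 10, a i * (w ^ 2 ^ (i : ℕ) - t) *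
      x ^ 2 ^ (i : ℕ)) = a m * (w ^ 2 ^ (m : ℕ) - t) := by
    have hiff : ∀ m i : Fin 10, 1023 ∣ 2 ^ (i : ℕ) + 1022 * 2 ^ (m : ℕ) ↔ i = m := by
      decide +kernel
    simp only [coeffAt_sum, coeffAt_mul_pow hK, hiff]
    simp
  simp only [h0] at h1
  have h2 : a m * (w ^ 2 ^ (m : ℕ) - t) = 0 := by rw [← h1]; simp [coeffAt]
  exact (mul_eq_zero.mp h2).resolve_right (sub_ne_zero.mpr hm)

theorem not_CCZEquivalent_cubicBinomial {k : Subfield K} (hk : ∀ z, z ∈ k ↔ z ^ 32 = z)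
    (hcard : Nat.card k = 32) {w u : K} (hw : w ^ 2 + w + 1 = 0)
    (hu : u ^ 31 = w ∨ u ^ 31 = w ^ 2) (d : ℕ) :
    ¬ CCZEquivalent (cubicBinomial u) (fun x : K => x ^ d) := by
  intro h
  have hF := isTriplicateAPN_cubicBinomial hK hk hcard hw hu
  have hw0 := hF.w_ne_zero
  have hw1 := hF.w_ne_one
  have hw3 := hF.w_cube
  have hww : w ≠ w ^ 2 := fun h' => hw1 (mul_right_cancel₀ hw0 (by rw [one_mul, ← sq, ← h']))
  have hu0 : u ≠ 0 := by
    rintro rfl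
    rcases hu with hu | hu
    · exact hw0 (by rw [← hu]; norm_num)
    · exact pow_ne_zero 2 hw0 (by rw [← hu]; norm_num)
  have hu155 : u ^ 155 ≠ 1 := by
    rw [show 155 = 31 * 5 from rfl, pow_mul]
    rcases hu with hu | hu <;> rw [hu] <;> intro h1
    · exact hw1 (by linear_combination (w ^ 3 + 1) * hw3 - w * h1)
    · exact hw1 (by linear_combination (-w ^ 7 - w ^ 4 - w) * hw3 + h1)
  obtain ⟨L, E, E', e, hL, hE', hLE⟩ := hF.exists_linear_normal_form hK h
  obtain ⟨a, ha⟩ := exists_linearized hK L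
  have hpow : ∀ i : ℕ, w ^ 2 ^ (2 * i) = w ∧ w ^ 2 ^ (2 * i + 1) = w ^ 2 := by
    intro i
    induction i with
    | zero => simp
    | succ i ih =>
      have h1 : w ^ 2 ^ (2 * (i + 1)) = w := by
        rw [show 2 * (i + 1) = 2 * i + 1 + 1 by ring, pow_succ 2, pow_mul, ih.2]
        linear_combination w * hw3
      exact ⟨h1, by rw [pow_succ 2, pow_mul, h1]⟩
  have hfour : ∀ i : ℕ, 2 ^ (2 * i) = 4 ^ i := fun i => by rw [pow_mul]; norm_num
  obtain ⟨x₁, hx₁⟩ := hL.2 1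
  rcases hF.semilinear_of_normal_form hK hL hE' hLE with hs | hs
  · have hodd : ∀ i : Fin 5, a ⟨2 * i + 1, by omega⟩ = 0 := fun i =>
      coeff_linearized_eq_zero hK ha hs _ (by simp only; rw [(hpow i).2]; exact hww.symm)
    let b : Fin 5 → K := fun i => a ⟨2 * i, by omega⟩
    have hLb : ∀ x, L x = ∑ i, b i * x ^ 4 ^ (i : ℕ) := by
      intro x
      rw [ha, sum_fin_ten]
      simp [hodd, b, hfour]
    refine not_normal_form hK hu0 hu155 (a := b) (fun hb => ?_) E E' e fun x => ?_
    · rw [hLb, hb] at hx₁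
      simp at hx₁
    · rw [← hLb, hLE]
  · -- here `L x` is `F_4`-linear in `x ^ 2`; substituting `x ^ 512` for `x` makes it linear in `x`
    have heven : ∀ i : Fin 5, a ⟨2 * i, by omega⟩ = 0 := fun i =>
      coeff_linearized_eq_zero hK ha hs _ (by simp only; rw [(hpow i).1]; exact hww)
    let b : Fin 5 → K := fun i => a ⟨2 * i + 1, by omega⟩
    have hLb : ∀ x, L x = ∑ i, b i * (x ^ 2) ^ 4 ^ (i : ℕ) := by
      intro x
      rw [ha, sum_fin_ten]
      have h2 : ∀ i : ℕ, x ^ 2 ^ (2 * i + 1) = (x ^ 2) ^ 4 ^ i := fun i => by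
        rw [pow_succ', pow_mul, hfour]
      simp [heven, b, h2]
    have h512 : ∀ x : K, (x ^ 512) ^ 2 = x := fun x => by
      rw [← pow_mul]
      exact pow_eq_self hK x
    let φ : K →+ K := (iterateFrobenius K 2 9).toAddMonoidHom
    have hφ : ∀ x, φ x = x ^ 512 := fun x => iterateFrobenius_def 2 9 x
    refine not_normal_form hK hu0 hu155 (a := b) (fun hb => ?_) (E.comp φ) E' (512 * e) fun x => ?_
    · rw [hLb, hb] at hx₁
      simp at hx₁
    · have h1 := hLb (x ^ 512)
      rw [h512] at h1
      rw [← h1, hLE, AddMonoidHom.comp_apply, hφ, pow_mul]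

end Final

theorem theorem1 {K : Type*} [Field K] [Finite K] (hK : Nat.card K = 2 ^ 10)
    (k : Subfield K) (hk : Nat.card k = 2 ^ 5) (ω : K) (hω : orderOf ω = 3) :
    (∀ u : K, u ≠ 0 →
      (IsAPN (fun x : K => x ^ 3 + u * x ^ 36) ↔
        u ∈ {y : K | ∃ c ∈ k, c ≠ 0 ∧ y = ω * c} ∪ {y : K | ∃ c ∈ k, c ≠ 0 ∧ y = ω ^ 2 * c})) ∧
    (∀ u ∈ {y : K | ∃ c ∈ k, c ≠ 0 ∧ y = ω * c} ∪ {y : K | ∃ c ∈ k, c ≠ 0 ∧ y = ω ^ 2 * c},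
      ∀ d : ℕ, ¬ CCZEquivalent (fun x : K => x ^ 3 + u * x ^ 36) (fun x : K => x ^ d)) := by
  have := Fintype.ofFinite K
  have hK' : Fintype.card K = 1024 := by rw [← Nat.card_eq_fintype_card, hK]; norm_num
  have : CharP K 2 := charP_of_card_eq_prime_pow (f := 10) (by rw [hK']; norm_num)
  have hcard : Nat.card k = 32 := by rw [hk]; norm_num
  have hmem := mem_iff_pow_eq_self hcard
  have hω3 : ω ^ 3 = 1 := by rw [← hω]; exact pow_orderOf_eq_one ω
  have hω1 : ω ≠ 1 := by
    rintro rfl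
    simp at hω
  have hω0 : ω ≠ 0 := by
    rintro rfl
    simp at hω3
  have hroot : ω ^ 2 + ω + 1 = 0 := by
    have : (ω - 1) * (ω ^ 2 + ω + 1) = 0 := by linear_combination hω3
    exact (mul_eq_zero.mp this).resolve_left (sub_ne_zero.mpr hω1)
  have hω23 : (ω ^ 2) ^ 3 = 1 := by rw [← pow_mul, mul_comm, pow_mul, hω3, one_pow]
  have hset : ∀ u : K, u ≠ 0 → (u ∈ {y : K | ∃ c ∈ k, c ≠ 0 ∧ y = ω * c} ∪
      {y : K | ∃ c ∈ k, c ≠ 0 ∧ y = ω ^ 2 * c} ↔ u ^ 31 = ω ∨ u ^ 31 = ω ^ 2) := fun u hu => by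
    rw [Set.mem_union, mem_mul_subfield_iff hmem hω3 hu, mem_mul_subfield_iff hmem hω23 hu]
  constructor
  · intro u hu
    rw [hset u hu]
    change IsAPN (cubicBinomial u) ↔ _
    rw [isAPN_cubicBinomial_iff]
    constructor
    · intro h
      by_contra! hne
      obtain ⟨x, y, hx, hy, hxy, h0⟩ :=
        exists_polarForm_cubicBinomial_eq_zero' hK' hroot hu hne.1 hne.2
      exact (h x y hx h0).elim hy hxy
    · exact fun h => (isTriplicateAPN_cubicBinomial hK' hmem hcard hroot h).apn
  · intro u hu d
    have hu0 : u ≠ 0 := by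
      rcases hu with ⟨c, -, hc, rfl⟩ | ⟨c, -, hc, rfl⟩
      · exact mul_ne_zero hω0 hc
      · exact mul_ne_zero (pow_ne_zero 2 hω0) hc
    exact not_CCZEquivalent_cubicBinomial hK' hmem hcard hroot ((hset u hu0).mp hu) d
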